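/- Let $V$ be a finite set of points (nodes) in the Euclidean plane, and write $|uv|$ and $|uv|_\infty$ for the $L_2$ and the $L_\infty$ distance of $u$ and $v$. The two axis-parallel lines through a node $u$ divide the plane minus $u$ into four quadrants $Q_1(u),\dots,Q_4(u)$; each is half-open and contains its clockwise, but not its counterclockwise, bounding ray (for instance $Q_1(u)=\{v : x(v)>x(u),\ y(v)\ge y(u)\}$). The Yao graph $Y_4$ on $V$ is obtained by picking, for every node $u$ and every quadrant $Q_i(u)$ that contains a node of $V$, exactly one directed edge $\overrightarrow{uv}$ with $v\in V\cap Q_i(u)$ and $|uv|$ minimal; ties are broken arbitrarily. The Yao graph $Y_4^\infty$ on $V$ is obtained in the same way with $|uv|_\infty$ in place of $|uv|$, except that ties are broken by always selecting the most counterclockwise edge. Edge directions are then ignored in both graphs. For every finite $V$, every graph $Y_4$ on $V$ obtained in this way (whatever the choice among ties), and every edge $ab$ of $Y_4^\infty$, the graph $Y_4$ contains a path from $a$ to $b$ whose Euclidean length (the sum of the Euclidean lengths of its edges) is at most $(29+23\sqrt{2})\,|ab|$. -/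

import Mathlib

/-- The Euclidean plane; `dist` on it is the Euclidean (L2) distance. -/
abbrev Plane : Type := EuclideanSpace ℝ (Fin 2)

/-- The four quadrants at `u`, numbered counterclockwise from the upper right one. They are the
cones between the four axis-parallel rays from `u`; each is half-open: it contains its clockwise
bounding ray, not the counterclockwise one, and not `u`. So they partition the plane minus `u`. -/
def quadrant : Fin 4 → Plane → Set Plane
  | 0, u => {v | u 0 < v 0 ∧ u 1 ≤ v 1}
  | 1, u => {v | v 0 ≤ u 0 ∧ u 1 < v 1}
  | 2, u => {v | v 0 < u 0 ∧ v 1 ≤ u 1}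
  | 3, u => {v | u 0 ≤ v 0 ∧ v 1 < u 1}

/-- The `L_∞` distance. -/
noncomputable def distInf (u v : Plane) : ℝ := max |u 0 - v 0| |u 1 - v 1|

/-- For `v` and `w` in one quadrant at `u`: the ray from `u` through `v` lies strictly
counterclockwise from the ray through `w`. -/
def IsCCWFrom (u v w : Plane) : Prop :=
  0 < (w 0 - u 0) * (v 1 - u 1) - (w 1 - u 1) * (v 0 - u 0)

/-- `E` is the directed edge relation of a Yao graph `Y₄` on `V` in the Euclidean metric: in each
nonempty quadrant at each node `u` exactly one edge from `u` is picked, and it is a shortest one.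
Ties are broken arbitrarily, so `E` need not be determined by `V`. -/
structure IsYaoFour {V : Finset Plane} (E : V → V → Prop) : Prop where
  ne_of_edge : ∀ u v : V, E u v → u ≠ v
  pick : ∀ (u : V) (i : Fin 4), (∃ w : V, (w : Plane) ∈ quadrant i u) →
    ∃! v : V, (v : Plane) ∈ quadrant i u ∧ E u v
  shortest : ∀ (u v w : V) (i : Fin 4), E u v → (v : Plane) ∈ quadrant i u →
    (w : Plane) ∈ quadrant i u → dist (u : Plane) v ≤ dist (u : Plane) w

/-- The directed edges of the Yao graph `Y₄^∞` on `V` in the `L_∞` metric: in each quadrant at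
`u`, the `L_∞`-shortest edge from `u`, where ties are broken by taking the most counterclockwise
edge. -/
def YaoFourInfEdge {V : Finset Plane} (u v : V) : Prop :=
  ∃ i : Fin 4, (v : Plane) ∈ quadrant i u ∧
    ∀ w : V, (w : Plane) ∈ quadrant i u → w ≠ v →
      distInf u v < distInf u w ∨ (distInf u v = distInf u w ∧ IsCCWFrom (u : Plane) v w)

/-- The undirected graph `Y₄^∞` on `V`. -/
def yaoFourInf (V : Finset Plane) : SimpleGraph V := SimpleGraph.fromRel YaoFourInfEdge

/-- The Euclidean length of a walk: the sum of the lengths of its edges. -/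
noncomputable def walkLength {V : Finset Plane} {G : SimpleGraph V} {a b : V}
    (p : G.Walk a b) : ℝ :=
  (p.darts.map fun d => dist (d.fst : Plane) (d.snd : Plane)).sum

/-! Ranks refine the half-open quadrants into strict sign patterns, so up to the symmetries of the
square (`YaoFrame`) one configuration of each type has to be studied. For p below and to the left of
q, follow first-quadrant `Y₄` edges from p and third-quadrant edges from q. Both paths are monotone,
so inside the rectangle of p and q they cost at most the L1 distance. They meet, or they cross, or
one of them leaves the rectangle (`linked_or_exit`).

Crossings are resolved by descent on scale. Let a → b and c → e, of opposite quadrants and of length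
at most L, cross in a pinwheel. Since each edge is shortest in its quadrant, one of be, ae, bc is
shorter than L by a fixed factor (`pinwheel_shrinks`). The same path-following joins that pair, and
it needs crossings only at scale at most 9/10 L. An exit contradicts an empty rectangle, the
non-crossing of edges of one quadrant or the minimality of an edge, or else it creates a crossing of
edges of adjacent quadrants; these have their own descent (`adjacent_heads_linked`). A finite set
has a positive least distance, so both descents stop. The factor 24 reproduces itself because 53/2 ·
9/10 < 24.

For an edge ab of `Y₄^∞`, the square at a that reaches b is empty. The `Y₄` edge from b towards a
and, if needed, the one from a towards b either join a and b or lead to the same alternatives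
(`linked_of_square_empty`). The outcome is 40 |ab|, below the stated bound. -/

/-- `u` and `v` are joined in the undirected graph of `E` by a walk of `d`-length at most `r`. -/
def LinkedWithin {V : Type*} (E : V → V → Prop) (d : V → V → ℝ) (u v : V) (r : ℝ) : Prop :=
  ∃ p : (SimpleGraph.fromRel E).Walk u v, (p.darts.map fun e => d e.fst e.snd).sum ≤ r

/-! ### Walks of bounded length. -/

namespace LinkedWithin

variable {V : Type*} {E : V → V → Prop} {d : V → V → ℝ} {u v w : V} {r s : ℝ}

theorem refl (u : V) : LinkedWithin E d u u 0 :=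
  ⟨SimpleGraph.Walk.nil, by simp⟩

theorem mono (h : LinkedWithin E d u v r) (hrs : r ≤ s) : LinkedWithin E d u v s :=
  ⟨h.choose, h.choose_spec.trans hrs⟩

theorem of_edge (h : E u v) (hne : u ≠ v) : LinkedWithin E d u v (d u v) :=
  ⟨SimpleGraph.Walk.cons ((SimpleGraph.fromRel_adj E u v).2 ⟨hne, Or.inl h⟩)
    SimpleGraph.Walk.nil, by simp⟩

theorem trans (h : LinkedWithin E d u v r) (h' : LinkedWithin E d v w s) :
    LinkedWithin E d u w (r + s) := by
  obtain ⟨p, hp⟩ := h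
  obtain ⟨q, hq⟩ := h'
  exact ⟨p.append q, by simpa [SimpleGraph.Walk.darts_append] using add_le_add hp hq⟩

theorem symm (hd : ∀ u v, d u v = d v u) (h : LinkedWithin E d u v r) :
    LinkedWithin E d v u r := by
  obtain ⟨p, hp⟩ := h
  refine ⟨p.reverse, le_trans (le_of_eq ?_) hp⟩
  rw [SimpleGraph.Walk.darts_reverse, List.map_reverse, List.sum_reverse, List.map_map]
  congr 1
  exact List.map_congr_left fun e _ => hd _ _

end LinkedWithin

/-! ### Coordinate frames, empty rectangles and non-crossing edges. -/

/-- A Yao graph `E` seen in one of the eight axis-parallel coordinate frames. The injective ranks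
`X` and `Y` refine the order of the coordinates `x` and `y`; the quadrants are the sets cut out by
strict comparison of ranks. -/
structure YaoFrame {V : Type*} (E : V → V → Prop) (d : V → V → ℝ) where
  x : V → ℝ
  y : V → ℝ
  X : V → ℤ
  Y : V → ℤ
  X_inj : ∀ u v, X u = X v → u = v
  Y_inj : ∀ u v, Y u = Y v → u = v
  x_le : ∀ u v, X u ≤ X v → x u ≤ x v
  y_le : ∀ u v, Y u ≤ Y v → y u ≤ y v
  tie_x : ∀ u v w, x u = x v → x v = x w → Y u < Y v → Y v < Y w → (X u < X v ↔ X v < X w)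
  tie_y : ∀ u v w, y u = y v → y v = y w → X u < X v → X v < X w → (Y u < Y v ↔ Y v < Y w)
  d_nonneg : ∀ u v, 0 ≤ d u v
  d_sq : ∀ u v, d u v ^ 2 = (x u - x v) ^ 2 + (y u - y v) ^ 2
  eq_of_d : ∀ u v, d u v = 0 → u = v
  exists_edge : ∀ u w, u ≠ w →
    ∃ v, E u v ∧ u ≠ v ∧ (X u < X v ↔ X u < X w) ∧ (Y u < Y v ↔ Y u < Y w)
  le_of_edge : ∀ u v w, E u v → u ≠ v → u ≠ w → (X u < X v ↔ X u < X w) →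
    (Y u < Y v ↔ Y u < Y w) → d u v ≤ d u w

namespace YaoFrame

variable {V : Type*} {E : V → V → Prop} {d : V → V → ℝ}

/-- Reflection in the vertical axis. -/
def flipX (F : YaoFrame E d) : YaoFrame E d where
  x v := -F.x v
  y := F.y
  X v := -F.X v
  Y := F.Y
  X_inj u v h := F.X_inj u v (by omega)
  Y_inj := F.Y_inj
  x_le u v h := neg_le_neg (F.x_le v u (by omega))
  y_le := F.y_le
  tie_x u v w h1 h2 h3 h4 := by
    have := F.tie_x u v w (neg_injective h1) (neg_injective h2) h3 h4
    have h5 : F.X u ≠ F.X v := fun h => by rw [F.X_inj u v h] at h3; omega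
    have h6 : F.X v ≠ F.X w := fun h => by rw [F.X_inj v w h] at h4; omega
    omega
  tie_y u v w h1 h2 h3 h4 := by
    have := F.tie_y w v u h2.symm h1.symm (by omega) (by omega)
    have h5 : F.Y u ≠ F.Y v := fun h => by rw [F.Y_inj u v h] at h3; omega
    have h6 : F.Y v ≠ F.Y w := fun h => by rw [F.Y_inj v w h] at h4; omega
    omega
  d_nonneg := F.d_nonneg
  d_sq u v := by rw [F.d_sq]; ring
  eq_of_d := F.eq_of_d
  exists_edge u w h := by
    obtain ⟨v, h1, h2, h3, h4⟩ := F.exists_edge u w h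
    have h5 : F.X u ≠ F.X v := fun h => h2 (F.X_inj u v h)
    have h6 : F.X u ≠ F.X w := fun h' => h (F.X_inj u w h')
    exact ⟨v, h1, h2, by omega, h4⟩
  le_of_edge u v w h h1 h2 h3 h4 := by
    have h5 : F.X u ≠ F.X v := fun h => h1 (F.X_inj u v h)
    have h6 : F.X u ≠ F.X w := fun h => h2 (F.X_inj u w h)
    exact F.le_of_edge u v w h h1 h2 (by omega) h4

/-- Reflection in the diagonal. -/
def swap (F : YaoFrame E d) : YaoFrame E d where
  x := F.y
  y := F.x
  X := F.Y
  Y := F.X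
  X_inj := F.Y_inj
  Y_inj := F.X_inj
  x_le := F.y_le
  y_le := F.x_le
  tie_x := F.tie_y
  tie_y := F.tie_x
  d_nonneg := F.d_nonneg
  d_sq u v := by rw [F.d_sq]; ring
  eq_of_d := F.eq_of_d
  exists_edge u w h := by
    obtain ⟨v, h1, h2, h3, h4⟩ := F.exists_edge u w h
    exact ⟨v, h1, h2, h4, h3⟩
  le_of_edge u v w h h1 h2 h3 h4 := F.le_of_edge u v w h h1 h2 h4 h3

/-- Reflection in the horizontal axis. -/
def flipY (F : YaoFrame E d) : YaoFrame E d := F.swap.flipX.swap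

variable (F : YaoFrame E d)

@[simp] theorem flipX_x (v : V) : F.flipX.x v = -F.x v := rfl
@[simp] theorem flipX_y (v : V) : F.flipX.y v = F.y v := rfl
@[simp] theorem flipX_X (v : V) : F.flipX.X v = -F.X v := rfl
@[simp] theorem flipX_Y (v : V) : F.flipX.Y v = F.Y v := rfl
@[simp] theorem flipY_x (v : V) : F.flipY.x v = F.x v := rfl
@[simp] theorem flipY_y (v : V) : F.flipY.y v = -F.y v := rfl
@[simp] theorem flipY_X (v : V) : F.flipY.X v = F.X v := rfl
@[simp] theorem flipY_Y (v : V) : F.flipY.Y v = -F.Y v := rfl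
@[simp] theorem swap_x (v : V) : F.swap.x v = F.y v := rfl
@[simp] theorem swap_y (v : V) : F.swap.y v = F.x v := rfl
@[simp] theorem swap_X (v : V) : F.swap.X v = F.Y v := rfl
@[simp] theorem swap_Y (v : V) : F.swap.Y v = F.X v := rfl

section
include F

theorem d_comm (u v : V) : d u v = d v u :=
  (sq_eq_sq₀ (F.d_nonneg u v) (F.d_nonneg v u)).1 (by rw [F.d_sq, F.d_sq]; ring)

theorem d_pos {u v : V} (h : u ≠ v) : 0 < d u v :=
  lt_of_le_of_ne (F.d_nonneg u v) fun h' => h (F.eq_of_d u v h'.symm)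

end

variable {F} {u v w p q : V}

theorem ne_of_X (h : F.X u < F.X v) : u ≠ v := fun h' => by rw [h'] at h; omega

theorem ne_of_Y (h : F.Y u < F.Y v) : u ≠ v := fun h' => by rw [h'] at h; omega

theorem d_le_d (hx : (F.x u - F.x v) ^ 2 ≤ (F.x p - F.x q) ^ 2)
    (hy : (F.y u - F.y v) ^ 2 ≤ (F.y p - F.y q) ^ 2) : d u v ≤ d p q :=
  (sq_le_sq₀ (F.d_nonneg u v) (F.d_nonneg p q)).1 (by rw [F.d_sq, F.d_sq]; linarith)

theorem sq_le_of_d_le (h : d u v ≤ d p q) :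
    (F.x u - F.x v) ^ 2 + (F.y u - F.y v) ^ 2 ≤ (F.x p - F.x q) ^ 2 + (F.y p - F.y q) ^ 2 := by
  rw [← F.d_sq, ← F.d_sq]
  exact pow_le_pow_left₀ (F.d_nonneg u v) h 2

theorem eq_of_coord (hx : F.x u = F.x v) (hy : F.y u = F.y v) : u = v :=
  F.eq_of_d u v (by have := F.d_sq u v; rw [hx, hy] at this; simpa using this)

theorem exists_edge₁ (hX : F.X u < F.X w) (hY : F.Y u < F.Y w) :
    ∃ v, E u v ∧ F.X u < F.X v ∧ F.Y u < F.Y v ∧ d u v ≤ d u w := by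
  obtain ⟨v, h1, h2, h3, h4⟩ := F.exists_edge u w (ne_of_X hX)
  exact ⟨v, h1, h3.2 hX, h4.2 hY, F.le_of_edge u v w h1 h2 (ne_of_X hX) h3 h4⟩

theorem exists_edge₃ (hX : F.X w < F.X u) (hY : F.Y w < F.Y u) :
    ∃ v, E u v ∧ F.X v < F.X u ∧ F.Y v < F.Y u ∧ d u v ≤ d u w := by
  obtain ⟨v, h1, h2, h3, h4⟩ := exists_edge₁ (F := F.flipX.flipY) (u := u) (w := w)
    (by simpa using hX) (by simpa using hY)
  exact ⟨v, h1, by simpa using h2, by simpa using h3, h4⟩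

theorem le_of_edge₁ (h : E u v) (hX : F.X u < F.X v) (hY : F.Y u < F.Y v)
    (hX' : F.X u < F.X w) (hY' : F.Y u < F.Y w) : d u v ≤ d u w :=
  F.le_of_edge u v w h (ne_of_X hX) (ne_of_X hX') (by simp [hX, hX']) (by simp [hY, hY'])

theorem le_of_edge₂ (h : E u v) (hX : F.X v < F.X u) (hY : F.Y u < F.Y v)
    (hX' : F.X w < F.X u) (hY' : F.Y u < F.Y w) : d u v ≤ d u w :=
  le_of_edge₁ (F := F.flipX) h (by simpa using hX) (by simpa using hY) (by simpa using hX')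
    (by simpa using hY')

theorem le_of_edge₃ (h : E u v) (hX : F.X v < F.X u) (hY : F.Y v < F.Y u)
    (hX' : F.X w < F.X u) (hY' : F.Y w < F.Y u) : d u v ≤ d u w :=
  le_of_edge₂ (F := F.flipY) h (by simpa using hX) (by simpa using hY) (by simpa using hX')
    (by simpa using hY')

theorem le_of_edge₄ (h : E u v) (hX : F.X u < F.X v) (hY : F.Y v < F.Y u)
    (hX' : F.X u < F.X w) (hY' : F.Y w < F.Y u) : d u v ≤ d u w :=
  le_of_edge₁ (F := F.flipY) h (by simpa using hX) (by simpa using hY) (by simpa using hX')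
    (by simpa using hY')

/-- The rectangle spanned by an edge of the first quadrant contains no other node. -/
theorem rect_empty₁ (h : E u v) (hX : F.X u < F.X w) (hY : F.Y u < F.Y w)
    (hX' : F.X w ≤ F.X v) (hY' : F.Y w ≤ F.Y v) : w = v := by
  have h1 := sq_le_of_d_le (F := F)
    (le_of_edge₁ h (hX.trans_le hX') (hY.trans_le hY') hX hY)
  have hx1 := F.x_le u w hX.le
  have hy1 := F.y_le u w hY.le
  have hx2 := F.x_le w v hX'
  have hy2 := F.y_le w v hY'
  have hx3 : F.x w = F.x v := by
    by_contra hne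
    have : F.x w < F.x v := lt_of_le_of_ne hx2 hne
    nlinarith
  have hy3 : F.y w = F.y v := by
    by_contra hne
    have : F.y w < F.y v := lt_of_le_of_ne hy2 hne
    nlinarith
  exact eq_of_coord hx3 hy3

theorem rect_empty₃ (h : E u v) (hX : F.X w < F.X u) (hY : F.Y w < F.Y u)
    (hX' : F.X v ≤ F.X w) (hY' : F.Y v ≤ F.Y w) : w = v :=
  rect_empty₁ (F := F.flipX.flipY) h (by simpa using hX) (by simpa using hY) (by simpa using hX')
    (by simpa using hY')

theorem rect_empty₄ (h : E u v) (hX : F.X u < F.X w) (hY : F.Y w < F.Y u)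
    (hX' : F.X w ≤ F.X v) (hY' : F.Y v ≤ F.Y w) : w = v :=
  rect_empty₁ (F := F.flipY) h (by simpa using hX) (by simpa using hY) (by simpa using hX')
    (by simpa using hY')

/-- Two edges of the same quadrant do not cross. -/
theorem not_cross_of_same_quadrant {a b c e : V} (hab : E a b) (hce : E c e)
    (X1 : F.X a < F.X c) (X2 : F.X c < F.X e) (X3 : F.X e < F.X b)
    (Y1 : F.Y c < F.Y a) (Y2 : F.Y a < F.Y b) (Y3 : F.Y b < F.Y e) : False := by
  have h1 := sq_le_of_d_le (F := F)
    (le_of_edge₁ (F := F) (w := e) hab (by omega) (by omega) (by omega) (by omega))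
  have h2 := sq_le_of_d_le (F := F)
    (le_of_edge₁ (F := F) (w := b) hce (by omega) (by omega) (by omega) (by omega))
  have x1 := F.x_le a c X1.le
  have x2 := F.x_le c e X2.le
  have x3 := F.x_le e b X3.le
  have y1 := F.y_le c a Y1.le
  have y2 := F.y_le a b Y2.le
  have y3 := F.y_le b e Y3.le
  -- Minimality of both edges gives (c - a)·(e - b) ≥ 0, while both coordinate terms of this product
  -- are nonpositive. So both vanish, which makes two of the nodes coincide.
  have hx : 0 ≤ (F.x c - F.x a) * (F.x b - F.x e) :=
    mul_nonneg (by linarith) (by linarith)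
  have hy : 0 ≤ (F.y a - F.y c) * (F.y e - F.y b) :=
    mul_nonneg (by linarith) (by linarith)
  have hx0 : (F.x c - F.x a) * (F.x b - F.x e) = 0 := by nlinarith
  have hy0 : (F.y a - F.y c) * (F.y e - F.y b) = 0 := by nlinarith
  have hbe : b ≠ e := ne_of_Y Y3
  have hac : a ≠ c := ne_of_X X1
  rcases mul_eq_zero.1 hx0 with hx' | hx' <;> rcases mul_eq_zero.1 hy0 with hy' | hy'
  · exact hac (eq_of_coord (F := F) (by linarith) (by linarith))
  · refine hbe (eq_of_coord (F := F) ?_ (by linarith))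
    have : F.y e = F.y b := by linarith
    rw [this] at h1
    nlinarith
  · refine hbe (eq_of_coord (F := F) (by linarith) ?_)
    have : F.x e = F.x b := by linarith
    rw [this] at h2
    nlinarith
  · exact hbe (eq_of_coord (F := F) (by linarith) (by linarith))

end YaoFrame

/-! ### Monotone paths followed towards each other. -/

namespace YaoFrame

variable {V : Type*} {E : V → V → Prop} {d : V → V → ℝ} {F : YaoFrame E d} {u v w p q : V}

theorem d_le_l1 (hX : F.X u ≤ F.X v) (hY : F.Y u ≤ F.Y v) :
    d u v ≤ (F.x v - F.x u) + (F.y v - F.y u) := by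
  have hx := F.x_le u v hX
  have hy := F.y_le u v hY
  refine abs_le_of_sq_le_sq' ?_ (by linarith) |>.2
  rw [F.d_sq]
  nlinarith

/-- The sharp constant √2 is rounded up to 3/2. -/
theorem l1_le (F : YaoFrame E d) (u v : V) :
    (F.x v - F.x u) + (F.y v - F.y u) ≤ 3 / 2 * d u v := by
  have h0 := F.d_nonneg u v
  refine abs_le_of_sq_le_sq' ?_ (by linarith) |>.2
  have := F.d_sq u v
  nlinarith [sq_nonneg (F.x v - F.x u - (F.y v - F.y u))]

/-- `Chain F p x x'` says that `x → x'` is an edge on a path of first-quadrant edges which starts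
at `p`. -/
inductive Chain (F : YaoFrame E d) (p : V) : V → V → Prop
  | first {x' : V} : E p x' → F.X p < F.X x' → F.Y p < F.Y x' → Chain F p p x'
  | next {x x' x'' : V} : Chain F p x x' → E x' x'' → F.X x' < F.X x'' → F.Y x' < F.Y x'' →
      Chain F p x' x''

theorem Chain.edge {x x' : V} (h : Chain F p x x') :
    E x x' ∧ F.X x < F.X x' ∧ F.Y x < F.Y x' := by
  cases h <;> exact ⟨‹_›, ‹_›, ‹_›⟩

theorem Chain.le {x x' : V} (h : Chain F p x x') : F.X p ≤ F.X x ∧ F.Y p ≤ F.Y x := by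
  induction h with
  | first => exact ⟨le_rfl, le_rfl⟩
  | next h _ _ _ ih => exact ⟨ih.1.trans h.edge.2.1.le, ih.2.trans h.edge.2.2.le⟩

theorem Chain.linked {x x' : V} (h : Chain F p x x') :
    LinkedWithin E d p x ((F.x x - F.x p) + (F.y x - F.y p)) := by
  induction h with
  | first => exact (LinkedWithin.refl p).mono (by simp)
  | next h _ _ _ ih =>
    obtain ⟨h1, h2, h3⟩ := h.edge
    refine (ih.trans (LinkedWithin.of_edge h1 (ne_of_X h2))).mono ?_
    linarith [d_le_l1 h2.le h3.le]

/-- A path which passes to the right of `w` starts to the left of `w`, unless `w` lies to the left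
of its first node. -/
theorem Chain.exists_passing_below {x x' : V} (h : Chain F p x x') (hX : F.X w < F.X x')
    (hY : F.Y x' < F.Y w) : F.X w < F.X p ∨
      ∃ z z', Chain F p z z' ∧ F.X z < F.X w ∧ F.Y z < F.Y w ∧ F.X w < F.X z' ∧
        F.Y z' < F.Y w := by
  induction h with
  | @first x' h1 h2 h3 =>
    rcases lt_trichotomy (F.X w) (F.X p) with h | h | h
    · exact Or.inl h
    · rw [F.X_inj _ _ h] at hY; omega
    · exact Or.inr ⟨p, x', .first h1 h2 h3, h, by omega, hX, hY⟩
  | @next x x' x'' hc h1 h2 h3 ih =>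
    rcases lt_trichotomy (F.X w) (F.X x') with h | h | h
    · exact ih h (by omega)
    · rw [F.X_inj _ _ h] at hY; omega
    · exact Or.inr ⟨x', x'', .next hc h1 h2 h3, h, by omega, hX, hY⟩

/-- Follow first-quadrant edges from `p` and third-quadrant edges from `q` inside the rectangle
of `p` and `q`. Either the two paths meet, or they cross in a pinwheel, or the first one leaves the
rectangle through the top, or the second one leaves it through the left side. -/
theorem meet_or_cross_or_exit (F : YaoFrame E d) {p q : V} (hX : F.X p < F.X q)
    (hY : F.Y p < F.Y q) :
    LinkedWithin E d p q ((F.x q - F.x p) + (F.y q - F.y p)) ∨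
    (∃ x x' y y', E x x' ∧ E y y' ∧ F.X p ≤ F.X x ∧ F.Y p ≤ F.Y x ∧ F.X y ≤ F.X q ∧ F.Y y ≤ F.Y q ∧
      F.X x < F.X y' ∧ F.X y' < F.X y ∧ F.X y < F.X x' ∧
      F.Y y' < F.Y x ∧ F.Y x < F.Y x' ∧ F.Y x' < F.Y y ∧
      LinkedWithin E d p x ((F.x x - F.x p) + (F.y x - F.y p)) ∧
      LinkedWithin E d q y ((F.x q - F.x y) + (F.y q - F.y y))) ∨
    (∃ x x', E x x' ∧ F.X p ≤ F.X x ∧ F.Y p ≤ F.Y x ∧ F.Y x < F.Y q ∧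
      F.X x < F.X x' ∧ F.X x' < F.X q ∧ F.Y q < F.Y x' ∧
      LinkedWithin E d p x ((F.x x - F.x p) + (F.y x - F.y p))) ∨
    (∃ y y', E y y' ∧ F.X p < F.X y ∧ F.X y ≤ F.X q ∧ F.Y y ≤ F.Y q ∧
      F.X y' < F.X p ∧ F.Y p < F.Y y' ∧ F.Y y' < F.Y y ∧
      LinkedWithin E d q y ((F.x q - F.x y) + (F.y q - F.y y))) := by
  set Goal : Prop := _ ∨ _ with hG
  -- The path of p has passed below q and left through the right side. Descend from q, keeping the
  -- current node y above an edge x → x' of that path; `n` bounds the height of y over p, in ranks.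
  have key : ∀ n : ℕ, ∀ x x' y, (F.Y y - F.Y p).toNat ≤ n → Chain F p x x' → F.X x < F.X y →
      F.Y x < F.Y y → F.X y < F.X x' → F.Y x' < F.Y y → F.X y ≤ F.X q → F.Y y ≤ F.Y q →
      LinkedWithin E d q y ((F.x q - F.x y) + (F.y q - F.y y)) → Goal := by
    intro n
    induction n with
    | zero =>
      intro x x' y hn hc h1 h2
      have := hc.le
      omega
    | succ n ih =>
      intro x x' y hn hc h1 h2 h3 h4 h5 h6 hl
      obtain ⟨e1, e2, e3⟩ := hc.edge
      obtain ⟨g1, g2⟩ := hc.le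
      obtain ⟨z, f1, f2, f3, -⟩ := exists_edge₃ h1 h2
      have hz : d y z ≤ (F.x y - F.x z) + (F.y y - F.y z) :=
        (F.d_comm y z).trans_le (d_le_l1 f2.le f3.le)
      have hlz : LinkedWithin E d q z ((F.x q - F.x z) + (F.y q - F.y z)) :=
        (hl.trans (LinkedWithin.of_edge f1 (ne_of_X f2).symm)).mono (by linarith)
      rcases lt_trichotomy (F.X z) (F.X x) with hx | hx | hx
      · have hy : F.Y x < F.Y z := by
          by_contra hy
          have := rect_empty₃ f1 h1 h2 hx.le (by omega)
          rw [this] at hx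
          omega
        have key2 : F.X z < F.X p ∨ ∃ w w', Chain F p w w' ∧ F.X w < F.X z ∧ F.Y w < F.Y z ∧
            F.X z < F.X w' ∧ F.Y w' < F.Y z := by
          cases hc with
          | first => exact Or.inl hx
          | next hc' _ _ _ => exact hc'.exists_passing_below hx hy
        rcases key2 with h | ⟨w, w', hw, k1, k2, k3, k4⟩
        · exact Or.inr (Or.inr (Or.inr ⟨y, z, f1, by omega, h5, h6, h, by omega, f3, hl⟩))
        · exact ih w w' z (by omega) hw k1 k2 k3 k4 (by omega) (by omega) hlz
      · have hxz := F.X_inj _ _ hx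
        subst hxz
        refine Or.inl ((hc.linked.trans (hlz.symm F.d_comm)).mono (by linarith))
      · rcases lt_trichotomy (F.Y z) (F.Y x) with hy | hy | hy
        · exact Or.inr (Or.inl ⟨x, x', y, z, e1, f1, g1, g2, h5, h6, hx, f2, h3, hy, e3, h4,
            hc.linked, hl⟩)
        · rw [F.Y_inj _ _ hy] at hx; omega
        · have hy' : F.Y x' < F.Y z := by
            by_contra hy'
            have := rect_empty₁ e1 hx hy (by omega) (by omega)
            rw [this] at f2
            omega
          exact ih x x' z (by omega) hc hx hy (by omega) hy' (by omega) (by omega) hlz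
  -- Extend the path of p until it reaches q or leaves the rectangle; leaving beyond both sides
  -- would put q into the empty rectangle of an edge.
  have start : ∀ n : ℕ, ∀ x x', (F.X q - F.X x).toNat ≤ n → Chain F p x x' → F.X x < F.X q →
      F.Y x < F.Y q → Goal := by
    intro n
    induction n with
    | zero => intro x x' hn _ h; omega
    | succ n ih =>
      intro x x' hn hc h1 h2
      obtain ⟨e1, e2, e3⟩ := hc.edge
      obtain ⟨g1, g2⟩ := hc.le
      by_cases hq : x' = q
      · subst hq
        refine Or.inl ((hc.linked.trans (LinkedWithin.of_edge e1 (ne_of_X e2))).mono ?_)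
        linarith [d_le_l1 e2.le e3.le]
      have hXq : F.X x' ≠ F.X q := fun h => hq (F.X_inj _ _ h)
      have hYq : F.Y x' ≠ F.Y q := fun h => hq (F.Y_inj _ _ h)
      rcases lt_or_gt_of_ne hXq with hx | hx <;> rcases lt_or_gt_of_ne hYq with hy | hy
      · obtain ⟨z, f1, f2, f3, -⟩ := exists_edge₁ hx hy
        exact ih x' z (by omega) (.next hc f1 f2 f3) hx hy
      · exact Or.inr (Or.inr (Or.inl ⟨x, x', e1, g1, g2, h2, e2, hx, hy, hc.linked⟩))
      · exact key _ x x' q le_rfl hc h1 h2 hx hy le_rfl le_rfl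
          ((LinkedWithin.refl q).mono (by simp))
      · exact absurd (rect_empty₁ e1 h1 h2 hx.le hy.le).symm hq
  obtain ⟨z, f1, f2, f3, -⟩ := exists_edge₁ hX hY
  exact start _ p z le_rfl (.first f1 f2 f3) hX hY

/-- Whenever a first-quadrant edge `a → b` and a third-quadrant edge `c → e`, both of length at
most `L`, cross in a pinwheel, their heads are joined by a walk of length at most `24 * L`. -/
def CrossingHeadsLinked (E : V → V → Prop) (d : V → V → ℝ) (L : ℝ) : Prop :=
  ∀ (F : YaoFrame E d) (a b c e : V), E a b → E c e →
    F.X a < F.X e → F.X e < F.X c → F.X c < F.X b → F.Y e < F.Y a → F.Y a < F.Y b → F.Y b < F.Y c →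
    d a b ≤ L → d c e ≤ L → LinkedWithin E d b e (24 * L)

/-- Write L for the distance of p and q. In a crossing the two path pieces and one edge cost at most
the L1 distance, hence 3/2 L; the other edge costs L and the heads 24 L, so 53/2 = 3/2 + 1 + 24. An
exiting edge is at most as long as the distance from its tail to the goal, because the goal lies in
the same quadrant. -/
theorem linked_or_exit (F : YaoFrame E d) {p q : V} (hL : CrossingHeadsLinked E d (d p q))
    (hX : F.X p < F.X q) (hY : F.Y p < F.Y q) :
    LinkedWithin E d p q (53 / 2 * d p q) ∨
    (∃ x x', E x x' ∧ F.X p ≤ F.X x ∧ F.Y p ≤ F.Y x ∧ F.Y x < F.Y q ∧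
      F.X x < F.X x' ∧ F.X x' < F.X q ∧ F.Y q < F.Y x' ∧ d x x' ≤ d x q ∧ d x x' ≤ d p q ∧
      LinkedWithin E d p x' (3 / 2 * d p q)) ∨
    (∃ y y', E y y' ∧ F.X p < F.X y ∧ F.X y ≤ F.X q ∧ F.Y y ≤ F.Y q ∧
      F.X y' < F.X p ∧ F.Y p < F.Y y' ∧ F.Y y' < F.Y y ∧ d y y' ≤ d y p ∧ d y y' ≤ d p q ∧
      LinkedWithin E d q y' (3 / 2 * d p q)) := by
  have hl := F.l1_le p q
  have h0 := F.d_nonneg p q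
  have hxpq := F.x_le p q hX.le
  have hypq := F.y_le p q hY.le
  rcases F.meet_or_cross_or_exit hX hY with h | ⟨x, x', y, y', e1, e2, a1, a2, a3, a4, b1, b2, b3,
    c1, c2, c3, l1, l2⟩ | ⟨x, x', e1, a1, a2, a3, b1, b2, b3, l1⟩ |
    ⟨y, y', e1, a1, a2, a3, b1, b2, b3, l1⟩
  · exact Or.inl (h.mono (by linarith))
  · left
    have k1 := F.x_le p x a1
    have k2 := F.y_le p x a2
    have k3 := F.x_le y q a3
    have k4 := F.y_le y q a4
    have k5 := F.x_le x y (by omega)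
    have k6 := F.y_le x y (by omega)
    have hxy : d x y ≤ d p q := d_le_d (F := F) (by nlinarith) (by nlinarith)
    have d1 : d x x' ≤ d x y :=
      le_of_edge₁ (F := F) e1 (by omega) (by omega) (by omega) (by omega)
    have d2 : d y y' ≤ d x y := by
      rw [F.d_comm x y]
      exact le_of_edge₃ (F := F) e2 (by omega) (by omega) (by omega) (by omega)
    have d3 := d_le_l1 (F := F) (u := x) (v := y) (by omega) (by omega)
    have key := hL F x x' y y' e1 e2 b1 b2 b3 c1 c2 c3 (d1.trans hxy) (d2.trans hxy)
    have s1 := LinkedWithin.of_edge (d := d) e1 (ne_of_Y c2)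
    have s2 := (LinkedWithin.of_edge (d := d) e2 (ne_of_X b2).symm).symm F.d_comm
    refine ((((l1.trans s1).trans key).trans s2).trans (l2.symm F.d_comm)).mono ?_
    linarith
  · right; left
    have k1 := F.x_le p x a1
    have k2 := F.y_le p x a2
    have k3 := F.x_le x q (by omega)
    have k4 := F.y_le x q (by omega)
    have d1 : d x x' ≤ d x q :=
      le_of_edge₁ (F := F) e1 (by omega) (by omega) (by omega) (by omega)
    have d2 : d x q ≤ d p q := d_le_d (F := F) (by nlinarith) (by nlinarith)
    have d3 := d_le_l1 (F := F) (u := x) (v := q) (by omega) (by omega)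
    refine ⟨x, x', e1, a1, a2, a3, b1, b2, b3, d1, d1.trans d2,
      (l1.trans (LinkedWithin.of_edge e1 (ne_of_X b1))).mono ?_⟩
    linarith
  · right; right
    have k1 := F.x_le p y (by omega)
    have k2 := F.y_le p y (by omega)
    have k3 := F.x_le y q a2
    have k4 := F.y_le y q a3
    have d1 : d y y' ≤ d y p :=
      le_of_edge₃ (F := F) e1 (by omega) (by omega) (by omega) (by omega)
    have d2 : d p y ≤ d p q := d_le_d (F := F) (by nlinarith) (by nlinarith)
    have d3 := d_le_l1 (F := F) (u := p) (v := y) (by omega) (by omega)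
    rw [F.d_comm p y] at d2 d3
    refine ⟨y, y', e1, a1, a2, a3, b1, b2, b3, d1, d1.trans d2,
      (l1.trans (LinkedWithin.of_edge e1 (ne_of_Y b3).symm)).mono ?_⟩
    linarith

end YaoFrame

/-! ### Metric estimates for crossing edges. -/

/-- Coordinates of the crossing point of a horizontal-ish and a vertical-ish segment. The first one
goes from the origin to `(B, β)`, the second one from `(e₁, e₂)` to `(c₁, c₂)`. -/
theorem exists_crossing_point {B β c₁ c₂ e₁ e₂ : ℝ} (hc₁ : 0 ≤ c₁) (hc₁' : c₁ ≤ B) (he₁ : 0 ≤ e₁)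
    (he₁' : e₁ ≤ B) (hc₂ : 0 ≤ c₂) (hc₂' : β ≤ c₂) (he₂ : e₂ ≤ 0) (he₂' : e₂ ≤ β)
    (hdet : 0 < B * (c₂ - e₂) - β * (c₁ - e₁)) :
    ∃ s t : ℝ, 0 ≤ s ∧ s ≤ 1 ∧ 0 ≤ t ∧ t ≤ 1 ∧ c₁ = s * B + t * (c₁ - e₁) ∧
      c₂ = s * β + t * (c₂ - e₂) := by
  -- Cramer's rule.
  refine ⟨(c₁ * (c₂ - e₂) - c₂ * (c₁ - e₁)) / (B * (c₂ - e₂) - β * (c₁ - e₁)),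
    (B * c₂ - β * c₁) / (B * (c₂ - e₂) - β * (c₁ - e₁)), ?_, ?_, ?_, ?_, ?_, ?_⟩
  · apply div_nonneg _ hdet.le
    nlinarith
  · rw [div_le_one hdet]
    nlinarith [mul_nonneg (sub_nonneg.2 hc₁') (sub_nonneg.2 he₂'),
      mul_nonneg (sub_nonneg.2 he₁') (sub_nonneg.2 hc₂')]
  · apply div_nonneg _ hdet.le
    nlinarith
  · rw [div_le_one hdet]
    nlinarith [mul_nonneg he₁ (sub_nonneg.2 he₂'), mul_nonneg (sub_nonneg.2 he₁') (neg_nonneg.2 he₂)]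
  · rw [div_mul_eq_mul_div, div_mul_eq_mul_div, ← add_div, eq_div_iff hdet.ne']
    ring
  · rw [div_mul_eq_mul_div, div_mul_eq_mul_div, ← add_div, eq_div_iff hdet.ne']
    ring

namespace YaoFrame

variable {V : Type*} {E : V → V → Prop} {d : V → V → ℝ}

/-- The distances between the endpoints of two crossing segments `ab` and `ce`, in terms of the
distances `P, p, q, Q` of `a, b, c, e` from the crossing point and the cosine `k` of the angle
between `a → b` and `e → c`. -/
theorem exists_crossing_data (F : YaoFrame E d) {a b c e : V} (x1 : F.x a ≤ F.x c)
    (x2 : F.x c ≤ F.x b) (x3 : F.x a ≤ F.x e) (x4 : F.x e ≤ F.x b) (y1 : F.y a ≤ F.y c)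
    (y2 : F.y b ≤ F.y c) (y3 : F.y e ≤ F.y a) (y4 : F.y e ≤ F.y b)
    (hdet : 0 < (F.x b - F.x a) * (F.y c - F.y e) - (F.y b - F.y a) * (F.x c - F.x e)) :
    ∃ P p q Q k : ℝ, 0 ≤ P ∧ 0 ≤ p ∧ 0 ≤ q ∧ 0 ≤ Q ∧ -1 ≤ k ∧ k ≤ 1 ∧ P + p = d a b ∧
      q + Q = d c e ∧ d a c ^ 2 = P ^ 2 + q ^ 2 + 2 * P * q * k ∧
      d b e ^ 2 = p ^ 2 + Q ^ 2 + 2 * p * Q * k ∧ d b c ^ 2 = p ^ 2 + q ^ 2 - 2 * p * q * k ∧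
      d a e ^ 2 = P ^ 2 + Q ^ 2 - 2 * P * Q * k ∧
      k * (d a b * d c e) =
        (F.x b - F.x a) * (F.x c - F.x e) + (F.y b - F.y a) * (F.y c - F.y e) := by
  obtain ⟨s, t, hs0, hs1, ht0, ht1, hx, hy⟩ := exists_crossing_point
    (B := F.x b - F.x a) (β := F.y b - F.y a) (c₁ := F.x c - F.x a) (c₂ := F.y c - F.y a)
    (e₁ := F.x e - F.x a) (e₂ := F.y e - F.y a) (by linarith) (by linarith) (by linarith)
    (by linarith) (by linarith) (by linarith) (by linarith) (by linarith) (by linarith)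
  have hab := F.d_sq a b
  have hce := F.d_sq c e
  have hac := F.d_sq a c
  have hbe := F.d_sq b e
  have hbc := F.d_sq b c
  have hae := F.d_sq a e
  have hl : 0 < d a b := F.d_pos fun h => by
    subst h; simp at hdet
  have hm : 0 < d c e := F.d_pos fun h => by
    subst h; simp at hdet
  generalize d a b = l at *
  generalize d c e = m at *
  obtain ⟨wx, hwx⟩ : ∃ w, w = F.x b - F.x a := ⟨_, rfl⟩
  obtain ⟨wy, hwy⟩ : ∃ w, w = F.y b - F.y a := ⟨_, rfl⟩
  obtain ⟨zx, hzx⟩ : ∃ w, w = F.x c - F.x e := ⟨_, rfl⟩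
  obtain ⟨zy, hzy⟩ : ∃ w, w = F.y c - F.y e := ⟨_, rfl⟩
  rw [sub_sub_sub_cancel_right, ← hwx, ← hzx] at hx
  rw [sub_sub_sub_cancel_right, ← hwy, ← hzy] at hy
  rw [← hzx, ← hzy] at hce
  rw [← hwx, ← hwy, ← hzx, ← hzy]
  have hl2 : l ^ 2 = wx ^ 2 + wy ^ 2 := by rw [hab, hwx, hwy]; ring
  have hm2 : m ^ 2 = zx ^ 2 + zy ^ 2 := by rw [hce]
  have hlm : 0 < l * m := mul_pos hl hm
  obtain ⟨k, hk⟩ : ∃ k, k = (wx * zx + wy * zy) / (l * m) := ⟨_, rfl⟩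
  have hk' : k * (l * m) = wx * zx + wy * zy := by
    rw [hk, div_mul_cancel₀ _ hlm.ne']
  have hcs : (wx * zx + wy * zy) ^ 2 ≤ (l * m) ^ 2 := by
    rw [mul_pow, hl2, hm2]
    nlinarith [sq_nonneg (wx * zy - wy * zx)]
  have hcs' := abs_le_of_sq_le_sq' hcs hlm.le
  have hcx : F.x c - F.x a = s * wx + t * zx := hx
  have hcy : F.y c - F.y a = s * wy + t * zy := hy
  refine ⟨s * l, (1 - s) * l, t * m, (1 - t) * m, k, mul_nonneg hs0 hl.le,
    mul_nonneg (by linarith) hl.le, mul_nonneg ht0 hm.le, mul_nonneg (by linarith) hm.le, ?_, ?_,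
    by ring, by ring, ?_, ?_, ?_, ?_, hk'⟩
  · rw [hk, le_div_iff₀ hlm]; rw [neg_one_mul]; exact hcs'.1
  · rw [hk, div_le_one hlm]; exact hcs'.2
  · have h1 : F.x a - F.x c = -(s * wx + t * zx) := by linear_combination -hcx
    have h2 : F.y a - F.y c = -(s * wy + t * zy) := by linear_combination -hcy
    rw [hac, h1, h2]
    linear_combination (-s ^ 2) * hl2 - t ^ 2 * hm2 - 2 * s * t * hk'
  · have h1 : F.x b - F.x e = (1 - s) * wx + (1 - t) * zx := by
      linear_combination -hwx - hzx - hcx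
    have h2 : F.y b - F.y e = (1 - s) * wy + (1 - t) * zy := by
      linear_combination -hwy - hzy - hcy
    rw [hbe, h1, h2]
    linear_combination (-(1 - s) ^ 2) * hl2 - (1 - t) ^ 2 * hm2 - 2 * (1 - s) * (1 - t) * hk'
  · have h1 : F.x b - F.x c = (1 - s) * wx - t * zx := by
      linear_combination -hwx - hcx
    have h2 : F.y b - F.y c = (1 - s) * wy - t * zy := by
      linear_combination -hwy - hcy
    rw [hbc, h1, h2]
    linear_combination (-(1 - s) ^ 2) * hl2 - t ^ 2 * hm2 + 2 * (1 - s) * t * hk'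
  · have h1 : F.x a - F.x e = -(s * wx - (1 - t) * zx) := by
      linear_combination -hzx - hcx
    have h2 : F.y a - F.y e = -(s * wy - (1 - t) * zy) := by
      linear_combination -hzy - hcy
    rw [hae, h1, h2]
    linear_combination (-s ^ 2) * hl2 - (1 - t) ^ 2 * hm2 + 2 * s * (1 - t) * hk'

end YaoFrame

/-- P, p, q, Q are the distances of a, b, c, e from the crossing point. If be exceeds 9/10 L, then p
+ Q > 9/10 L, so q - p < L/10. If also ae is not short, p ≤ P, so P > 45/100 L. Now ab ≤ ac forces
the angle between the edges to be small, and bc² = (q - p)² + 2pq(1 - k) is then small. -/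
theorem crossing_shrinks_of_opposite {P p q Q k L : ℝ} (hP : 0 ≤ P) (hp : 0 ≤ p) (hq : 0 ≤ q)
    (hQ : 0 ≤ Q) (hk : 0 ≤ k) (hk1 : k ≤ 1) (hl : 0 < P + p) (hm : 0 < q + Q)
    (hL : P + p ≤ L) (hL' : q + Q ≤ L)
    (h1 : (P + p) ^ 2 ≤ P ^ 2 + q ^ 2 + 2 * P * q * k)
    (h2 : (q + Q) ^ 2 ≤ P ^ 2 + q ^ 2 + 2 * P * q * k) :
    p ^ 2 + Q ^ 2 + 2 * p * Q * k ≤ (9 / 10 * L) ^ 2 ∨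
      2 * (P ^ 2 + Q ^ 2 - 2 * P * Q * k) < (P + p) ^ 2 ∨
      2 * (p ^ 2 + q ^ 2 - 2 * p * q * k) < (q + Q) ^ 2 := by
  by_contra! hcon
  obtain ⟨hA, hB, hC⟩ := hcon
  have hPq : 0 ≤ P * q := mul_nonneg hP hq
  have hpq : p ≤ q := by
    have : (P + p) ^ 2 ≤ (P + q) ^ 2 := by nlinarith
    have := abs_le_of_sq_le_sq' this (by linarith)
    linarith [this.2]
  have hQP : Q ≤ P := by
    have : (q + Q) ^ 2 ≤ (P + q) ^ 2 := by nlinarith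
    have := abs_le_of_sq_le_sq' this (by linarith)
    linarith [this.2]
  have hsum : 9 / 10 * L < p + Q := by
    have : (9 / 10 * L) ^ 2 < (p + Q) ^ 2 := by nlinarith [mul_nonneg hp hQ]
    exact lt_of_pow_lt_pow_left₀ 2 (by linarith) this
  have hPp : p ≤ P := by
    by_contra h
    have h3 : 0 ≤ P * Q * k := mul_nonneg (mul_nonneg hP hQ) hk
    nlinarith
  have hqQ : Q ≤ q := by
    by_contra h
    have h3 : 0 ≤ p * q * k := mul_nonneg (mul_nonneg hp hq) hk
    nlinarith
  have hLpos : 0 < L := by linarith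
  have hP45 : 45 / 100 * L < P := by linarith
  have hq65 : q < 65 / 100 * L := by linarith
  have h3 : 2 * P * p * (1 - k) ≤ (q - p) * (q + p + 2 * P * k) := by nlinarith
  have h4 : (q - p) * (q + p + 2 * P * k) ≤ (1 / 10 * L) * (21 / 10 * L) := by
    have : 2 * P * k ≤ 2 * P := by nlinarith
    have : 0 ≤ P * k := mul_nonneg hP hk
    exact mul_le_mul (by linarith) (by linarith) (by linarith) (by linarith)
  have h5 : 2 * p * (1 - k) * P ≤ 21 / 100 * L * L := by nlinarith
  have h6 : 2 * p * (1 - k) ≤ 21 / 45 * L := by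
    by_contra! h
    have : 21 / 45 * L * (45 / 100 * L) < 2 * p * (1 - k) * P :=
      mul_lt_mul'' h hP45 (by linarith) (by linarith)
    linarith
  have h7 : 2 * p * (1 - k) * q ≤ 21 / 45 * L * (65 / 100 * L) :=
    mul_le_mul h6 hq65.le hq (by linarith)
  have h8 : (q - p) ^ 2 ≤ (1 / 10 * L) ^ 2 := pow_le_pow_left₀ (by linarith) (by linarith) 2
  have h9 : (9 / 10 * L) ^ 2 ≤ (q + Q) ^ 2 := pow_le_pow_left₀ (by linarith) (by linarith) 2
  nlinarith

/-- U, W, C, D are the distances of u, v, c, e from the crossing point, and k is the cosine of the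
angle between u → v and c → e. If ev is not short, uv ≤ ue forces D close to U and W small; ce ≤ uc
then forces C small. So cv ≤ W + C is short against ce = C + D. -/
theorem crossing_shrinks_of_adjacent {U W C D k : ℝ} (hU : 0 ≤ U) (hW : 0 ≤ W) (hC : 0 ≤ C)
    (hD : 0 ≤ D) (hUW : 0 < U + W) (hk0 : -1 ≤ k) (hk1 : k ≤ 1)
    (h1 : (U + W) ^ 2 ≤ U ^ 2 + D ^ 2 + 2 * U * D * k)
    (h2 : (C + D) ^ 2 ≤ U ^ 2 + C ^ 2 - 2 * U * C * k) :
    W ^ 2 + D ^ 2 - 2 * W * D * k ≤ (9 / 10 * (U + W)) ^ 2 ∨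
      2 * (W ^ 2 + C ^ 2 + 2 * W * C * k) < (C + D) ^ 2 := by
  by_contra! hcon
  obtain ⟨hA, hB⟩ := hcon
  have hUD : 0 ≤ U * D := mul_nonneg hU hD
  have hUC : 0 ≤ U * C := mul_nonneg hU hC
  have hWD : W ≤ D := by
    have : (U + W) ^ 2 ≤ (U + D) ^ 2 := by nlinarith
    linarith [(abs_le_of_sq_le_sq' this (by linarith)).2]
  have hDU : D ≤ U := by
    have : (C + D) ^ 2 ≤ (C + U) ^ 2 := by nlinarith
    linarith [(abs_le_of_sq_le_sq' this (by linarith)).2]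
  have hUpos : 0 < U := by
    by_contra h
    linarith
  -- Stewart's theorem in the triangle u, v, e, with the crossing point on uv, combined with uv ≤
  -- ue.
  have h3 : (W ^ 2 + D ^ 2 - 2 * W * D * k) * U ≤ (D ^ 2 - W ^ 2) * (U + W) := by
    nlinarith [mul_le_mul_of_nonneg_left h1 hW]
  have h4 : 81 / 100 * (U + W) * U < D ^ 2 - W ^ 2 := by
    have : (9 / 10 * (U + W)) ^ 2 * U < (D ^ 2 - W ^ 2) * (U + W) :=
      lt_of_lt_of_le (mul_lt_mul_of_pos_right hA hUpos) h3
    have h : (81 / 100 * (U + W) * U) * (U + W) < (D ^ 2 - W ^ 2) * (U + W) := by nlinarith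
    exact lt_of_mul_lt_mul_right h hUW.le
  have h5 : 9 / 10 * U < D := by
    have : (9 / 10 * U) ^ 2 < D ^ 2 := by nlinarith
    exact lt_of_pow_lt_pow_left₀ 2 hD this
  have h6 : W ≤ 19 / 100 * U := by
    have h : 81 / 100 * U * (U + W) < (U - W) * (U + W) := by nlinarith
    linarith [lt_of_mul_lt_mul_right h hUW.le]
  have h7 : -(D * D) ≤ 2 * (U * k) * D := by nlinarith
  have h8 : -D ≤ 2 * (U * k) := by
    have : -D * D ≤ 2 * (U * k) * D := by linarith
    exact le_of_mul_le_mul_right this (by linarith)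
  have h9 : C * D ≤ 19 / 100 * U * U := by nlinarith
  have h10 : C ≤ 19 / 90 * U := by
    by_contra! h
    have : 19 / 90 * U * (9 / 10 * U) < C * D := mul_lt_mul'' h h5 (by linarith) (by linarith)
    nlinarith
  have h11 : W ^ 2 + C ^ 2 + 2 * W * C * k ≤ (W + C) ^ 2 := by
    nlinarith [mul_nonneg hW hC]
  have h12 : (W + C) ^ 2 ≤ (41 / 100 * U) ^ 2 := pow_le_pow_left₀ (by linarith) (by linarith) 2
  have h13 : (9 / 10 * U) ^ 2 ≤ (C + D) ^ 2 := pow_le_pow_left₀ (by linarith) (by linarith) 2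
  nlinarith

/-! ### Descent on scale for crossing edges. -/

namespace YaoFrame

variable {V : Type*} {E : V → V → Prop} {d : V → V → ℝ} {F : YaoFrame E d}

theorem pinwheel_shrinks {a b c e : V} {L : ℝ} (hab : E a b) (hce : E c e)
    (X1 : F.X a < F.X e) (X2 : F.X e < F.X c) (X3 : F.X c < F.X b)
    (Y1 : F.Y e < F.Y a) (Y2 : F.Y a < F.Y b) (Y3 : F.Y b < F.Y c)
    (hL : d a b ≤ L) (hL' : d c e ≤ L) :
    d b e ≤ 9 / 10 * L ∨ 2 * d a e ^ 2 < d a b ^ 2 ∨ 2 * d b c ^ 2 < d c e ^ 2 := by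
  have x1 := F.x_le a e X1.le
  have x2 := F.x_le e c X2.le
  have x3 := F.x_le c b X3.le
  have y1 := F.y_le e a Y1.le
  have y2 := F.y_le a b Y2.le
  have y3 := F.y_le b c Y3.le
  have h1 : d a b ≤ d a c :=
    le_of_edge₁ (F := F) hab (by omega) (by omega) (by omega) (by omega)
  have h2 : d c e ≤ d a c := by
    rw [F.d_comm a c]
    exact le_of_edge₃ (F := F) hce (by omega) (by omega) (by omega) (by omega)
  -- The ranks allow degenerate pinwheels; parallel edges would make two nodes coincide.
  have hdet : 0 < (F.x b - F.x a) * (F.y c - F.y e) - (F.y b - F.y a) * (F.x c - F.x e) := by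
    by_contra! hcon
    have g1 : 0 ≤ ((F.x b - F.x a) - (F.x c - F.x e)) * (F.y c - F.y e) :=
      mul_nonneg (by linarith) (by linarith)
    have g2 : 0 ≤ (F.x c - F.x e) * ((F.y c - F.y e) - (F.y b - F.y a)) :=
      mul_nonneg (by linarith) (by linarith)
    have z1 := le_antisymm (b := (0 : ℝ)) (by linarith) g1
    have z2 := le_antisymm (b := (0 : ℝ)) (by linarith) g2
    have hea : e ≠ a := ne_of_Y Y1
    have hcb : c ≠ b := ne_of_X X3
    have s1 := sq_le_of_d_le (F := F) h1
    have s2 := sq_le_of_d_le (F := F) h2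
    rcases mul_eq_zero.1 z1 with z1 | z1
    · rcases mul_eq_zero.1 z2 with z2 | z2
      · have hx : F.x c = F.x e := by linarith
        have hx' : F.x a = F.x e := by linarith
        refine hea (eq_of_coord (F := F) hx'.symm ?_)
        rw [hx, hx'] at s2
        nlinarith
      · exact hea (eq_of_coord (F := F) (by linarith) (by linarith))
    · have hy : F.y c = F.y e := by linarith
      have hy' : F.y a = F.y e := by linarith
      have hy'' : F.y b = F.y e := by linarith
      refine hcb (eq_of_coord (F := F) ?_ (by linarith))
      rw [hy, hy', hy''] at s1
      nlinarith
  obtain ⟨P, p, q, Q, k, hP, hp, hq, hQ, hk0, hk1, e1, e2, e3, e4, e5, e6, e7⟩ :=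
    F.exists_crossing_data (a := a) (b := b) (c := c) (e := e) (by linarith) (by linarith)
      (by linarith) (by linarith) (by linarith) (by linarith) (by linarith) (by linarith) hdet
  have hl : 0 < d a b := F.d_pos (ne_of_Y Y2)
  have hm : 0 < d c e := F.d_pos (ne_of_X X2).symm
  -- Both a → b and e → c point up and to the right, so their angle is not obtuse.
  have hk : 0 ≤ k := by
    have : 0 ≤ k * (d a b * d c e) := by
      rw [e7]
      exact add_nonneg (mul_nonneg (by linarith) (by linarith))
        (mul_nonneg (by linarith) (by linarith))
    exact nonneg_of_mul_nonneg_left this (mul_pos hl hm)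
  have s1 := pow_le_pow_left₀ hl.le h1 2
  have s2 := pow_le_pow_left₀ hm.le h2 2
  rw [e3, ← e1] at s1
  rw [e3, ← e2] at s2
  rw [e5, e6, ← e1, ← e2]
  rcases crossing_shrinks_of_opposite hP hp hq hQ hk hk1 (e1 ▸ hl) (e2 ▸ hm) (e1.trans_le hL)
    (e2.trans_le hL') s1 s2 with h | h | h
  · left
    rw [← e4] at h
    exact (abs_le_of_sq_le_sq' h (by linarith)).2
  · exact Or.inr (Or.inl h)
  · exact Or.inr (Or.inr h)

theorem adjacent_crossing_shrinks {c e u v : V} (hce : E c e) (huv : E u v)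
    (X1 : F.X u < F.X e) (X2 : F.X e < F.X c) (X3 : F.X c < F.X v)
    (Y1 : F.Y e < F.Y v) (Y2 : F.Y v < F.Y u) (Y3 : F.Y u < F.Y c) :
    d e v ≤ 9 / 10 * d u v ∨ 2 * d c v ^ 2 < d c e ^ 2 := by
  have x1 := F.x_le u e X1.le
  have x2 := F.x_le e c X2.le
  have x3 := F.x_le c v X3.le
  have y1 := F.y_le e v Y1.le
  have y2 := F.y_le v u Y2.le
  have y3 := F.y_le u c Y3.le
  have h1 : d u v ≤ d u e :=
    le_of_edge₄ (F := F) huv (by omega) (by omega) (by omega) (by omega)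
  have h2 : d c e ≤ d u c := by
    rw [F.d_comm u c]
    exact le_of_edge₃ (F := F) hce (by omega) (by omega) (by omega) (by omega)
  have hdet : 0 < (F.x v - F.x u) * (F.y c - F.y e) - (F.y v - F.y u) * (F.x c - F.x e) := by
    by_contra! hcon
    have g1 : 0 ≤ (F.x v - F.x u) * (F.y c - F.y e) := mul_nonneg (by linarith) (by linarith)
    have g2 : 0 ≤ (F.y u - F.y v) * (F.x c - F.x e) := mul_nonneg (by linarith) (by linarith)
    have z1 := le_antisymm (b := (0 : ℝ)) (by linarith) g1
    have heu : e ≠ u := (ne_of_X X1).symm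
    have hve : v ≠ e := (ne_of_Y Y1).symm
    have s1 := sq_le_of_d_le (F := F) h1
    have s2 := sq_le_of_d_le (F := F) h2
    rcases mul_eq_zero.1 z1 with z1 | z1
    · have hx : F.x c = F.x e := by linarith
      have hx' : F.x u = F.x e := by linarith
      refine heu (eq_of_coord (F := F) hx'.symm ?_)
      rw [hx, hx'] at s2
      nlinarith
    · have hy : F.y v = F.y e := by linarith
      have hy' : F.y u = F.y e := by linarith
      refine hve (eq_of_coord (F := F) ?_ hy)
      rw [hy, hy'] at s1
      nlinarith
  obtain ⟨U, W, C, D, k, hU, hW, hC, hD, hk0, hk1, e1, e2, e3, e4, e5, e6, -⟩ :=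
    F.exists_crossing_data (a := u) (b := v) (c := c) (e := e) (by linarith) (by linarith)
      (by linarith) (by linarith) (by linarith) (by linarith) (by linarith) (by linarith) hdet
  have hl : 0 < d u v := F.d_pos (ne_of_Y Y2).symm
  have s1 := pow_le_pow_left₀ hl.le h1 2
  have s2 := pow_le_pow_left₀ (F.d_nonneg c e) h2 2
  rw [e6, ← e1] at s1
  rw [e3, ← e2] at s2
  rcases crossing_shrinks_of_adjacent (k := -k) hU hW hC hD (e1 ▸ hl) (by linarith) (by linarith)
    (by linarith) (by linarith) with h | h
  · left
    rw [e1] at h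
    refine (abs_le_of_sq_le_sq' ?_ (by linarith)).2
    rw [F.d_comm e v, e4]
    linarith
  · right
    rw [F.d_comm c v, e5, ← e2]
    linarith

/-- If the edge from `x` is no longer than `xa` and passes above `a`, then it ends close to `a`. -/
theorem sq_d_le_of_passing {a x z : V} (x1 : F.x a ≤ F.x z) (x2 : F.x z ≤ F.x x)
    (y1 : F.y x ≤ F.y a) (y2 : F.y a ≤ F.y z) (h : d x z ≤ d x a) :
    d a z ^ 2 ≤ 2 * (F.x x - F.x a) ^ 2 := by
  have s := sq_le_of_d_le (F := F) h
  rw [F.d_sq]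
  -- Since a lies vertically between x and z, the length bound leaves the height of z over a at most
  -- the width of xa; the width of az is at most that too.
  nlinarith [mul_nonneg (sub_nonneg.2 y1) (sub_nonneg.2 y2),
    mul_nonneg (sub_nonneg.2 x1) (sub_nonneg.2 x2)]

/-- 708/1000 slightly exceeds 1/√2. -/
theorem le_of_two_mul_sq_lt {r s : ℝ} (hs : 0 ≤ s) (h : 2 * r ^ 2 < s ^ 2) :
    r ≤ 708 / 1000 * s := by
  refine (abs_le_of_sq_le_sq' ?_ (by linarith)).2
  nlinarith [sq_nonneg s]

/-- The heads of two edges of adjacent quadrants which cross in a pinwheel are linked. -/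
theorem adjacent_heads_linked {δ L : ℝ} (hsep : ∀ u v, u ≠ v → δ ≤ d u v)
    (H : ∀ L' ≤ 9 / 10 * L, CrossingHeadsLinked E d L') (n : ℕ) :
    ∀ (F : YaoFrame E d) (A B r : ℝ) (c e u v : V), B * (9 / 10) ^ n < δ → A ≤ L → B ≤ L →
      20 * A ≤ r → 24 * B ≤ r → d c e ≤ A → d u v ≤ B → E c e → E u v →
      F.X u < F.X e → F.X e < F.X c → F.X c < F.X v →
      F.Y e < F.Y v → F.Y v < F.Y u → F.Y u < F.Y c → LinkedWithin E d e v r := by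
  induction n with
  | zero =>
    intro F A B r c e u v hB _ _ _ _ _ huv _ _ _ _ _ _ Y2 _
    have := hsep u v (ne_of_Y Y2).symm
    simp at hB
    linarith
  | succ n ih =>
    intro F A B r c e u v hB hAL hBL hAr hBr hA hB' hce huv X1 X2 X3 Y1 Y2 Y3
    have hce0 := F.d_nonneg c e
    have huv0 := F.d_nonneg u v
    rcases adjacent_crossing_shrinks hce huv X1 X2 X3 Y1 Y2 Y3 with hs | hs
    · rcases F.linked_or_exit (H (d e v) (by linarith)) (X2.trans X3) Y1 with
        h | ⟨x, x', e1, a1, a2, a3, b1, b2, b3, d1, d2, l⟩ |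
        ⟨y, y', e1, a1, a2, a3, b1, b2, b3, d1, d2, l⟩
      · exact h.mono (by linarith)
      -- The empty rectangle of u → v forces x' above u, so u → v and x → x' form the same picture
      -- reflected, with lengths (B, 9/10 B). The cost is (3/2 · 9/10 + 24 · 9/10) B < 24 B.
      · have hY : F.Y u < F.Y x' := by
          by_contra hY
          have := rect_empty₄ (F := F) (w := x') huv (by omega)
            (lt_of_le_of_ne (by omega) fun h => by
              rw [F.Y_inj _ _ h] at b1; omega) (by omega) (by omega)
          rw [this] at b2
          omega
        have := ih F.flipX.swap B (9 / 10 * B) (216 / 10 * B) u v x x'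
          (by rw [pow_succ] at hB; linarith) hBL (by linarith) (by linarith) (by linarith) hB'
          (by linarith) huv e1 (by simpa using a3) (by simpa using Y2) (by simpa using hY)
          (by simpa using b2) (by simpa using b1) (by simp; omega)
        exact (l.trans (this.symm F.d_comm)).symm F.d_comm |>.mono (by linarith) |>.symm F.d_comm
      · exfalso
        have hX : F.X c < F.X y := by
          by_contra hX
          have := rect_empty₃ (F := F) (w := y) hce
            (lt_of_le_of_ne (by omega) fun h => by
              rw [F.X_inj _ _ h] at a3; omega) (by omega) (by omega) (by omega)
          rw [this] at a1
          omega
        exact not_cross_of_same_quadrant (F := F.flipX.flipY) e1 hce (by simpa using hX)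
          (by simpa using X2) (by simpa using b1) (by simp; omega) (by simpa using b3)
          (by simpa using b2)
    · have hcv := le_of_two_mul_sq_lt hce0 hs
      rcases F.flipY.linked_or_exit (p := c) (q := v) (H (d c v) (by linarith)) (by simpa using X3)
        (by simp; omega) with
        h | ⟨x, x', e1, a1, a2, a3, b1, b2, b3, d1, d2, l⟩ |
        ⟨y, y', e1, a1, a2, a3, b1, b2, b3, d1, d2, l⟩
      -- 1 + 53/2 · 708/1000 < 20, the reason for the factor 20.
      · have h' := ((LinkedWithin.of_edge (d := d) hce (ne_of_X X2).symm).symm F.d_comm).trans h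
        exact h'.mono (by linarith)
      · exfalso
        simp only [flipY_X, flipY_Y] at a1 a2 a3 b1 b2 b3
        have hY : F.Y u < F.Y x := by
          by_contra hY
          have := rect_empty₄ (F := F) (w := x) huv (by omega)
            (lt_of_le_of_ne (by omega) fun h => by
              rw [F.Y_inj _ _ h] at a1; omega) (by omega) (by omega)
          rw [this] at a3
          omega
        exact not_cross_of_same_quadrant (F := F.flipY) huv e1 (by simp; omega) (by simpa using b1)
          (by simpa using b2) (by simpa using hY) (by simpa using Y2) (by simpa using b3)
      · exfalso
        simp only [flipY_X, flipY_Y] at a1 a2 a3 b1 b2 b3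
        -- The edge y → y' passes to the left of c, so y' is closer to c than e, in the same
        -- quadrant of c.
        have h1 : d c e ≤ d c y' :=
          le_of_edge₃ (F := F) hce (by omega) (by omega) (by omega) (by omega)
        have k1 := F.x_le y' c (by omega)
        have k2 := F.x_le c y (by omega)
        have k3 := F.y_le y' c (by omega)
        have k4 := F.y_le y y' (by omega)
        have k5 := F.y_le v y (by omega)
        have h2 := sq_d_le_of_passing (F := F.flipX.flipY.swap) (a := c) (x := y) (z := y')
          (by simpa using k3) (by simpa using k4) (by simpa using k2) (by simpa using k1) d1
        simp only [swap_x, flipY_y, flipX_y] at h2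
        have h3 : (-F.y y - -F.y c) ^ 2 ≤ d c v ^ 2 := by
          rw [F.d_sq c v]
          nlinarith [sq_nonneg (F.x c - F.x v)]
        have h4 := pow_le_pow_left₀ hce0 h1 2
        linarith

/-- Return along ab and join a to e, now at distance below L/√2. A path from e passing over a would
end closer to a than b does; a path from a passing e on the right crosses c → e as an edge of an
adjacent quadrant, for a total of (1 + 3/2 · 708/1000 + 20) L < 24 L. -/
theorem crossing_heads_linked_of_tail {δ L : ℝ} (hδ : 0 < δ) (hsep : ∀ u v, u ≠ v → δ ≤ d u v)
    (H : ∀ L' ≤ 9 / 10 * L, CrossingHeadsLinked E d L') {a b c e : V} (hab : E a b) (hce : E c e)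
    (X1 : F.X a < F.X e) (X2 : F.X e < F.X c) (X3 : F.X c < F.X b)
    (Y1 : F.Y e < F.Y a) (Y2 : F.Y a < F.Y b) (Y3 : F.Y b < F.Y c)
    (hL : d a b ≤ L) (hL' : d c e ≤ L) (hs : 2 * d a e ^ 2 < d a b ^ 2) :
    LinkedWithin E d b e (24 * L) := by
  have hab0 := F.d_nonneg a b
  have hae := le_of_two_mul_sq_lt hab0 hs
  rw [F.d_comm a e] at hae
  have hba := (LinkedWithin.of_edge (d := d) hab (ne_of_Y Y2)).symm F.d_comm
  rcases F.flipX.linked_or_exit (p := e) (q := a) (H (d e a) (by linarith)) (by simpa using X1)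
    (by simpa using Y1) with
    h | ⟨x, x', e1, a1, a2, a3, b1, b2, b3, d1, d2, l⟩ |
    ⟨y, y', e1, a1, a2, a3, b1, b2, b3, d1, d2, l⟩
  · exact (hba.trans (h.symm F.d_comm)).mono (by linarith)
  · exfalso
    simp only [flipX_X, flipX_Y] at a1 a2 a3 b1 b2 b3
    have h1 : d a b ≤ d a x' :=
      le_of_edge₁ (F := F) hab (by omega) (by omega) (by omega) (by omega)
    have k1 := F.x_le x e (by omega)
    have k2 := F.x_le x' x (by omega)
    have k3 := F.x_le a x' (by omega)
    have h2 := sq_d_le_of_passing (F := F) k3 k2 (F.y_le x a (by omega)) (F.y_le a x' (by omega)) d1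
    have h3 : (F.x x - F.x a) ^ 2 ≤ d a e ^ 2 := by
      rw [F.d_sq a e]
      nlinarith [sq_nonneg (F.y a - F.y e)]
    have h4 := pow_le_pow_left₀ hab0 h1 2
    linarith
  · simp only [flipX_X, flipX_Y] at a1 a2 a3 b1 b2 b3
    have hX : F.X c < F.X y' := by
      by_contra hX
      have := rect_empty₃ (F := F) (w := y') hce
        (lt_of_le_of_ne (by omega) fun h => by
          rw [F.X_inj _ _ h] at b3; omega) (by omega) (by omega) (by omega)
      rw [this] at b1
      omega
    obtain ⟨n, hn⟩ := exists_pow_lt_of_lt_one (y := (9 / 10 : ℝ)) (div_pos hδ (d_pos F (ne_of_X X1).symm))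
      (by norm_num)
    rw [lt_div_iff₀ (d_pos F (ne_of_X X1).symm)] at hn
    have key := adjacent_heads_linked hsep H n F L (d e a) (20 * L) c e y y' (by linarith) le_rfl
      (by linarith) le_rfl (by linarith) hL' d2 hce e1 (by omega) X2 hX b2 b3 (by omega)
    exact ((hba.trans l).trans (key.symm F.d_comm)).mono (by linarith)

theorem crossing_heads_linked_step {δ L : ℝ} (hδ : 0 < δ) (hsep : ∀ u v, u ≠ v → δ ≤ d u v)
    (H : ∀ L' ≤ 9 / 10 * L, CrossingHeadsLinked E d L') : CrossingHeadsLinked E d L := by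
  intro F a b c e hab hce X1 X2 X3 Y1 Y2 Y3 hL hL'
  rcases pinwheel_shrinks hab hce X1 X2 X3 Y1 Y2 Y3 hL hL' with hs | hs | hs
  · have hbe := F.d_comm e b
    rcases F.linked_or_exit (p := e) (q := b) (H (d e b) (by linarith)) (by omega) (by omega) with
      h | ⟨x, x', e1, a1, a2, a3, b1, b2, b3, d1, d2, l⟩ |
      ⟨y, y', e1, a1, a2, a3, b1, b2, b3, d1, d2, l⟩
    · exact (h.symm F.d_comm).mono (by linarith [F.d_nonneg a b])
    -- The exiting edge would cross a → b, an edge of its own quadrant; the other exit would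
    -- likewise cross c → e.
    · exfalso
      have hY : F.Y x < F.Y a := by
        by_contra hY
        have := rect_empty₁ (F := F) (w := x) hab (by omega)
          (lt_of_le_of_ne (by omega) fun h => by
            rw [← F.Y_inj _ _ h] at a1; omega) (by omega) (by omega)
        rw [this] at a3
        omega
      exact not_cross_of_same_quadrant (F := F) hab e1 (by omega) b1 b2 hY Y2 b3
    · exfalso
      have hX : F.X c < F.X y := by
        by_contra hX
        have := rect_empty₃ (F := F) (w := y) hce
          (lt_of_le_of_ne (by omega) fun h => by
            rw [F.X_inj _ _ h] at a3; omega) (by omega) (by omega) (by omega)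
        rw [this] at a1
        omega
      exact not_cross_of_same_quadrant (F := F.flipX.flipY) e1 hce (by simpa using hX)
        (by simpa using X2) (by simpa using b1) (by simp; omega) (by simpa using b3)
        (by simpa using b2)
  · exact crossing_heads_linked_of_tail hδ hsep H hab hce X1 X2 X3 Y1 Y2 Y3 hL hL' hs
  -- Reflection in the antidiagonal exchanges the roles of the two edges.
  · refine (crossing_heads_linked_of_tail (F := F.flipX.flipY.swap) hδ hsep H hce hab
      (by simpa using Y3) (by simpa using Y2) (by simpa using Y1) (by simpa using X3)
      (by simpa using X2) (by simpa using X1) hL' hL ?_).symm F.d_comm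
    rwa [F.d_comm c b]

/-- After finitely many reductions by 9/10 the scale drops below the least distance δ, where no
edges exist. -/
theorem crossing_heads_linked {δ : ℝ} (hδ : 0 < δ) (hsep : ∀ u v, u ≠ v → δ ≤ d u v) (L : ℝ) :
    CrossingHeadsLinked E d L := by
  have key : ∀ n : ℕ, ∀ L : ℝ, L * (9 / 10) ^ n < δ → CrossingHeadsLinked E d L := by
    intro n
    induction n with
    | zero =>
      intro L hL F a b c e hab hce X1 X2 X3 Y1 Y2 Y3 h
      have := hsep a b (ne_of_Y Y2)
      simp at hL
      linarith
    | succ n ih =>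
      intro L hL
      refine crossing_heads_linked_step hδ hsep fun L' hL' => ih L' ?_
      have : L' * (9 / 10) ^ n ≤ 9 / 10 * L * (9 / 10) ^ n :=
        mul_le_mul_of_nonneg_right hL' (by positivity)
      rw [pow_succ] at hL
      linarith
  rcases le_or_gt L 0 with hL | hL
  · exact key 0 L (by simp; linarith)
  · obtain ⟨n, hn⟩ := exists_pow_lt_of_lt_one (y := (9 / 10 : ℝ)) (div_pos hδ hL) (by norm_num)
    rw [lt_div_iff₀ hL] at hn
    exact key n L (by linarith)

end YaoFrame

/-! ### Edges with an empty square. -/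

namespace YaoFrame

variable {V : Type*} {E : V → V → Prop} {d : V → V → ℝ}

/-- If `b` lies on the right side of a square with lower left corner `a` which contains no other
node, then `a` and `b` are linked. -/
theorem linked_of_square_empty {δ : ℝ} (hδ : 0 < δ) (hsep : ∀ u v, u ≠ v → δ ≤ d u v)
    (F : YaoFrame E d) {a b : V} (hX : F.X a < F.X b) (hY : F.Y a < F.Y b)
    (hs : F.y b - F.y a ≤ F.x b - F.x a)
    (hsq : ∀ w, F.X a < F.X w → F.Y a < F.Y w → w ≠ b → F.x w < F.x b →
      F.x b - F.x a ≤ F.y w - F.y a)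
    (hrect : ∀ w, F.X a < F.X w → F.X w < F.X b → F.Y a < F.Y w → F.Y w < F.Y b → False) :
    LinkedWithin E d a b (40 * d a b) := by
  have hC : ∀ L, CrossingHeadsLinked E d L := crossing_heads_linked hδ hsep
  have hab0 := F.d_nonneg a b
  have hxab := F.x_le a b hX.le
  have hyab := F.y_le a b hY.le
  have habsq := F.d_sq a b
  obtain ⟨e, hbe, X1, Y1, hd⟩ := exists_edge₃ hX hY
  rw [F.d_comm b a] at hd
  have lbe := (LinkedWithin.of_edge (d := d) hbe (ne_of_X X1).symm)
  by_cases hea : e = a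
  · subst hea
    exact (lbe.symm F.d_comm).mono (by linarith)
  have hXea : F.X e ≠ F.X a := fun h => hea (F.X_inj _ _ h)
  have hYea : F.Y e ≠ F.Y a := fun h => hea (F.Y_inj _ _ h)
  rcases lt_or_gt_of_ne hYea with hYe | hYe
  · have hXe : F.X a < F.X e := by
      by_contra h
      exact hea (rect_empty₃ (F := F) hbe hX hY (by omega) hYe.le).symm
    have x1 := F.x_le a e hXe.le
    have x2 := F.x_le e b X1.le
    have y1 := F.y_le e a hYe.le
    -- 1415/1000 exceeds √2: both the width and the depth of ae are at most the width of ab.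
    have hae : d e a ≤ 1415 / 1000 * d a b := by
      rw [F.d_comm a b] at hd
      have s := sq_le_of_d_le (F := F) hd
      refine (abs_le_of_sq_le_sq' ?_ (by linarith)).2
      rw [mul_pow, habsq, F.d_sq e a]
      nlinarith [mul_nonneg (sub_nonneg.2 hyab) (sub_nonneg.2 y1)]
    have hea0 : 0 < d e a := d_pos F (ne_of_X hXe).symm
    rcases F.flipX.linked_or_exit (p := e) (q := a) (hC _) (by simpa using hXe)
      (by simpa using hYe) with
      h | ⟨x, x', e1, a1, a2, a3, b1, b2, b3, d1, d2, l⟩ |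
      ⟨y, y', e1, a1, a2, a3, b1, b2, b3, d1, d2, l⟩
    · exact ((lbe.trans h).symm F.d_comm).mono (by linarith)
    · exfalso
      simp only [flipX_X, flipX_Y] at a1 a2 a3 b1 b2 b3
      -- By emptiness x' is above b. If it is strictly left of the right side's line, it lies at
      -- least as high as the top of the square, too far from x; if it is on that line, the monotone
      -- ranks exclude it.
      have hYx' : F.Y b < F.Y x' := by
        by_contra h
        rcases (not_lt.1 h).lt_or_eq with h | h
        · exact hrect x' (by omega) (by omega) b3 h
        · rw [F.Y_inj _ _ h] at b1
          omega
      have k1 := F.x_le x e (by omega)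
      have k2 := F.x_le x' x (by omega)
      have k3 := F.x_le a x' (by omega)
      have k4 := F.y_le x a (by omega)
      rcases (k2.trans (k1.trans x2)).lt_or_eq with hx | hx
      · have h1 := hsq x' (by omega) (by omega) (ne_of_Y hYx').symm hx
        have s := sq_le_of_d_le (F := F) d1
        have g1 : F.x x = F.x x' := by
          by_contra hne
          have := pow_pos (sub_pos.2 (lt_of_le_of_ne k2 (Ne.symm hne))) 2
          nlinarith [mul_nonneg (sub_nonneg.2 hxab) (sub_nonneg.2 k4)]
        rw [← g1] at hx k3
        nlinarith [mul_nonneg (sub_nonneg.2 hxab) (sub_nonneg.2 k4)]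
      · have := F.tie_x x b x' (by linarith) hx.symm (by omega) hYx'
        omega
    · simp only [flipX_X, flipX_Y] at a1 a2 a3 b1 b2 b3
      have hXy' : F.X b < F.X y' := by
        by_contra hXy'
        have := rect_empty₃ (F := F) (w := y') hbe
          (lt_of_le_of_ne (by omega) fun h => by
            rw [F.X_inj _ _ h] at b3; omega) (by omega) (by omega) (by omega)
        rw [this] at b1
        omega
      obtain ⟨n, hn⟩ := exists_pow_lt_of_lt_one (y := (9 / 10 : ℝ)) (div_pos hδ hea0) (by norm_num)
      rw [lt_div_iff₀ hea0] at hn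
      -- 34 is 24 · 1415/1000 rounded up.
      have key := adjacent_heads_linked hsep (fun L' _ => hC L') n F (L := 2 * d a b) (d a b)
        (d e a) (34 * d a b) b e y y' (by linarith) (by linarith) (by linarith) (by linarith)
        (by linarith) hd d2 hbe e1 (by omega) X1 hXy' b2 b3 (by omega)
      exact ((l.trans (key.symm F.d_comm)).trans (lbe.symm F.d_comm)).mono (by linarith)
  · have hXe : F.X e < F.X a := by
      by_contra h
      exact hrect e (by omega) X1 hYe Y1
    obtain ⟨c, hac, X2, Y2, hd'⟩ := exists_edge₁ hX hY
    have lac := LinkedWithin.of_edge (d := d) hac (ne_of_X X2)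
    by_cases hcb : c = b
    · subst hcb
      exact lac.mono (by linarith)
    have hXcb : F.X c ≠ F.X b := fun h => hcb (F.X_inj _ _ h)
    have hYcb : F.Y c ≠ F.Y b := fun h => hcb (F.Y_inj _ _ h)
    rcases lt_or_gt_of_ne hXcb with hXc | hXc
    · have hYc : F.Y b < F.Y c := by
        by_contra h
        exact hrect c X2 hXc Y2 (by omega)
      -- The edges a → c and b → e cross in a pinwheel seen in the swapped frame.
      have key := hC (d a b) F.swap a c b e hac hbe hYe Y1 hYc hXe X2 hXc hd' hd
      exact ((lac.trans key).trans (lbe.symm F.d_comm)).mono (by linarith)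
    · have hYc : F.Y c < F.Y b := by
        by_contra h
        exact hcb (rect_empty₁ (F := F) hac hX hY hXc.le (by omega)).symm
      have x1 := F.x_le b c hXc.le
      have y1 := F.y_le a c Y2.le
      have y2 := F.y_le c b hYc.le
      have hbc : d b c ≤ d a b := by
        have s := sq_le_of_d_le (F := F) hd'
        have : F.x c - F.x a ≤ 2 * (F.x b - F.x a) :=
          (abs_le_of_sq_le_sq' (by nlinarith) (by linarith)).2
        exact d_le_d (F := F) (by nlinarith) (by nlinarith)
      have hbc0 : 0 < d b c := d_pos F (ne_of_X hXc)
      rcases F.flipY.linked_or_exit (p := b) (q := c) (hC _) (by simpa using hXc)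
        (by simpa using hYc) with
        h | ⟨x, x', e1, a1, a2, a3, b1, b2, b3, d1, d2, l⟩ |
        ⟨y, y', e1, a1, a2, a3, b1, b2, b3, d1, d2, l⟩
      · exact (lac.trans (h.symm F.d_comm)).mono (by linarith)
      · simp only [flipY_X, flipY_Y] at a1 a2 a3 b1 b2 b3
        have hYx' : F.Y x' < F.Y a := by
          by_contra hYx'
          have := rect_empty₁ (F := F) (w := x') hac (by omega)
            (lt_of_le_of_ne (by omega) fun h => by
              rw [← F.Y_inj _ _ h] at b1; omega) (by omega) (by omega)
          rw [this] at b2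
          omega
        obtain ⟨n, hn⟩ := exists_pow_lt_of_lt_one (y := (9 / 10 : ℝ)) (div_pos hδ hbc0)
          (by norm_num)
        rw [lt_div_iff₀ hbc0] at hn
        have key := adjacent_heads_linked hsep (fun L' _ => hC L') n F.flipX.flipY.swap
          (L := 2 * d a b) (d a b) (d b c) (24 * d a b) a c x x' (by linarith) (by linarith)
          (by linarith) (by linarith) (by linarith) hd' d2 hac e1 (by simp; omega) (by simpa using Y2)
          (by simpa using hYx') (by simpa using b2) (by simpa using b1) (by simp; omega)
        exact ((lac.trans key).trans (l.symm F.d_comm)).mono (by linarith)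
      · exfalso
        simp only [flipY_X, flipY_Y] at a1 a2 a3 b1 b2 b3
        have hXy' : F.X y' ≤ F.X a := by
          by_contra h
          exact hrect y' (by omega) b1 (by omega) (by omega)
        have hay' : a ≠ y' := ne_of_Y (F := F) (by omega)
        have k1 := F.x_le y' a hXy'
        have k2 := F.x_le b y a1.le
        have k3 := F.y_le c y (by omega)
        have k4 := F.y_le y y' (by omega)
        have k5 := F.y_le y b (by omega)
        have s := sq_le_of_d_le (F := F) d1
        -- The edge y → y' spans the whole width from a to b, which is at least the height of ab.
        -- Being no longer than yb, it allows only equality, and then y' = a.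
        have g1 : (F.x b - F.x a + (F.x y - F.x b) + (F.x a - F.x y')) ^ 2 ≥
            (F.x b - F.x a) ^ 2 + (F.x y - F.x b) ^ 2 + (F.x a - F.x y') ^ 2 := by
          nlinarith [mul_nonneg (sub_nonneg.2 hxab) (sub_nonneg.2 k2),
            mul_nonneg (sub_nonneg.2 hxab) (sub_nonneg.2 k1),
            mul_nonneg (sub_nonneg.2 k1) (sub_nonneg.2 k2)]
        have g2 : (F.y y - F.y b) ^ 2 ≤ (F.y b - F.y a) ^ 2 - (F.y y - F.y a) ^ 2 := by
          nlinarith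
        have g3 : (F.y b - F.y a) ^ 2 ≤ (F.x b - F.x a) ^ 2 :=
          pow_le_pow_left₀ (by linarith) hs 2
        have g4 : F.x b - F.x a + (F.x y - F.x b) + (F.x a - F.x y') = F.x y - F.x y' := by ring
        rw [g4] at g1
        have q1 := sq_nonneg (F.x a - F.x y')
        have q2 := sq_nonneg (F.y y - F.y a)
        have q3 := sq_nonneg (F.y y - F.y y')
        have hx0 : F.x a - F.x y' = 0 := (pow_eq_zero_iff two_ne_zero).1 (by linarith)
        have hy0 : F.y y - F.y a = 0 := (pow_eq_zero_iff two_ne_zero).1 (by linarith)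
        have hy1 : F.y y - F.y y' = 0 := (pow_eq_zero_iff two_ne_zero).1 (by linarith)
        exact hay' (eq_of_coord (F := F) (by linarith) (by linarith))

end YaoFrame

/-! ### The standard frame and the edges of `Y₄^∞`. -/

/-- A finite type with an injective map to a linear order has integer ranks in that order. -/
theorem exists_rank {V α : Type*} [Finite V] [LinearOrder α] (f : V → α) :
    ∃ r : V → ℤ, ∀ u v, r u < r v ↔ f u < f v := by
  classical
  cases nonempty_fintype V
  have hmono : ∀ u v, f u < f v →
      (Finset.univ.filter fun w => f w < f u).card < (Finset.univ.filter fun w => f w < f v).card := by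
    intro u v h
    refine Finset.card_lt_card (Finset.ssubset_iff_of_subset ?_ |>.2 ⟨u, by simp [h], by simp⟩)
    intro w hw
    simp only [Finset.mem_filter, Finset.mem_univ, true_and] at hw ⊢
    exact hw.trans h
  refine ⟨fun u => ((Finset.univ.filter fun w => f w < f u).card : ℤ), fun u v => ?_⟩
  constructor
  · intro h
    by_contra hcon
    rcases (not_lt.1 hcon).lt_or_eq with h' | h'
    · have := hmono v u h'
      dsimp only at h
      omega
    · simp [h'] at h
  · intro h
    dsimp only
    exact_mod_cast hmono u v h

theorem exists_forall_dist_ge {V : Finset Plane} :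
    ∃ δ : ℝ, 0 < δ ∧ ∀ u v : V, u ≠ v → δ ≤ dist (u : Plane) v := by
  classical
  by_cases h : (Finset.univ.filter fun p : V × V => p.1 ≠ p.2).Nonempty
  · obtain ⟨p, hp, hmin⟩ := Finset.exists_min_image _
      (fun p : V × V => dist (p.1 : Plane) (p.2 : Plane)) h
    refine ⟨dist (p.1 : Plane) (p.2 : Plane), dist_pos.2 fun h => ?_, fun u v huv =>
      hmin (u, v) (by simpa using huv)⟩
    exact (Finset.mem_filter.1 hp).2 (Subtype.ext h)
  · refine ⟨1, one_pos, fun u v huv => absurd ⟨(u, v), by simpa using huv⟩ h⟩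

theorem exists_quadrant {u w : Plane} (h : u ≠ w) : ∃ i, w ∈ quadrant i u := by
  by_contra! hcon
  have h0 := hcon 0
  have h1 := hcon 1
  have h2 := hcon 2
  have h3 := hcon 3
  simp only [quadrant, Set.mem_ofPred_eq, not_and_or, not_lt, not_le] at h0 h1 h2 h3
  refine h (PiLp.ext fun i => ?_)
  fin_cases i <;> simp <;> grind

/-- The frame of the standard coordinates. -/
theorem exists_yaoFrame {V : Finset Plane} {E : V → V → Prop} (hE : IsYaoFour E) :
    ∃ F : YaoFrame E (fun u v => dist (u : Plane) (v : Plane)),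
      (∀ v, F.x v = (v : Plane) 0) ∧ (∀ v, F.y v = (v : Plane) 1) ∧
      (∀ u v, F.X u < F.X v ↔ (u : Plane) 0 < (v : Plane) 0 ∨
        (u : Plane) 0 = (v : Plane) 0 ∧ (v : Plane) 1 < (u : Plane) 1) ∧
      (∀ u v, F.Y u < F.Y v ↔ (u : Plane) 1 < (v : Plane) 1 ∨
        (u : Plane) 1 = (v : Plane) 1 ∧ (u : Plane) 0 < (v : Plane) 0) := by
  -- The lexicographic tie-breaks imitate an infinitesimal counterclockwise rotation, which moves
  -- the clockwise boundary ray of each quadrant into its interior.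
  obtain ⟨X, hX⟩ := exists_rank fun v : V => toLex ((v : Plane) 0, -(v : Plane) 1)
  obtain ⟨Y, hY⟩ := exists_rank fun v : V => toLex ((v : Plane) 1, (v : Plane) 0)
  replace hX : ∀ u v : V, X u < X v ↔ (u : Plane) 0 < (v : Plane) 0 ∨
      (u : Plane) 0 = (v : Plane) 0 ∧ (v : Plane) 1 < (u : Plane) 1 := fun u v => by
    rw [hX, Prod.Lex.toLex_lt_toLex]
    simp
  replace hY : ∀ u v : V, Y u < Y v ↔ (u : Plane) 1 < (v : Plane) 1 ∨
      (u : Plane) 1 = (v : Plane) 1 ∧ (u : Plane) 0 < (v : Plane) 0 := fun u v => by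
    rw [hY, Prod.Lex.toLex_lt_toLex]
  have hext : ∀ u v : V, (u : Plane) 0 = (v : Plane) 0 → (u : Plane) 1 = (v : Plane) 1 → u = v :=
    fun u v h0 h1 => Subtype.ext (PiLp.ext fun i => by fin_cases i <;> assumption)
  have hquad : ∀ (u v w : V) (i : Fin 4), (v : Plane) ∈ quadrant i u →
      ((w : Plane) ∈ quadrant i u ↔ u ≠ w ∧ (X u < X v ↔ X u < X w) ∧ (Y u < Y v ↔ Y u < Y w)) := by
    intro u v w i hv
    have hw := hext u w
    have hu : u = w → (u : Plane) 0 = (w : Plane) 0 ∧ (u : Plane) 1 = (w : Plane) 1 :=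
      fun h => by rw [h]; exact ⟨rfl, rfl⟩
    rw [hX, hX, hY, hY]
    fin_cases i <;> simp only [quadrant, Set.mem_ofPred_eq] at hv ⊢ <;> grind
  refine ⟨{ x := fun v => (v : Plane) 0
            y := fun v => (v : Plane) 1
            X := X
            Y := Y
            X_inj := fun u v h => ?_
            Y_inj := fun u v h => ?_
            x_le := fun u v h => ?_
            y_le := fun u v h => ?_
            tie_x := fun u v w h1 h2 h3 h4 => ?_
            tie_y := fun u v w h1 h2 h3 h4 => ?_
            d_nonneg := fun u v => dist_nonneg
            d_sq := fun u v => ?_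
            eq_of_d := fun u v h => Subtype.ext (dist_eq_zero.1 h)
            exists_edge := fun u w h => ?_
            le_of_edge := fun u v w h h1 h2 h3 h4 => ?_ },
    fun _ => rfl, fun _ => rfl, hX, hY⟩
  · have h1 := hX u v
    have h2 := hX v u
    have h3 := hext u v
    grind
  · have h1 := hY u v
    have h2 := hY v u
    have h3 := hext u v
    grind
  · have h1 := hX v u
    grind
  · have h1 := hY v u
    grind
  · rw [hY] at h3 h4
    rw [hX, hX]
    grind
  · rw [hX] at h3 h4
    rw [hY, hY]
    grind
  · rw [EuclideanSpace.dist_eq, Real.sq_sqrt (by positivity), Fin.sum_univ_two, Real.dist_eq,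
      Real.dist_eq, sq_abs, sq_abs]
  · obtain ⟨i, hi⟩ := exists_quadrant (u := (u : Plane)) (w := (w : Plane))
      fun h' => h (Subtype.ext h')
    obtain ⟨v, ⟨hv, he⟩, -⟩ := hE.pick u i ⟨w, hi⟩
    have := (hquad u w v i hi).1 hv
    exact ⟨v, he, this.1, this.2.1.symm, this.2.2.symm⟩
  · obtain ⟨i, hi⟩ := exists_quadrant (u := (u : Plane)) (w := (v : Plane))
      fun h' => h1 (Subtype.ext h')
    exact hE.shortest u v w i h hi ((hquad u v w i hi).2 ⟨h2, h3, h4⟩)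

/-- Reflection in the diagonal reduces to the case where ab is at least as wide as high. -/
theorem YaoFrame.linked_of_maximal_square_empty {V : Type*} {E : V → V → Prop} {d : V → V → ℝ}
    {δ : ℝ} (hδ : 0 < δ) (hsep : ∀ u v, u ≠ v → δ ≤ d u v) (F : YaoFrame E d) {a b : V}
    (hX : F.X a < F.X b) (hY : F.Y a < F.Y b)
    (hsq : ∀ w, F.X a < F.X w → F.Y a < F.Y w → w ≠ b →
      max (F.x b - F.x a) (F.y b - F.y a) ≤ max (F.x w - F.x a) (F.y w - F.y a))
    (hrect : ∀ w, F.X a < F.X w → F.X w < F.X b → F.Y a < F.Y w → F.Y w < F.Y b → False) :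
    LinkedWithin E d a b (40 * d a b) := by
  rcases le_total (F.y b - F.y a) (F.x b - F.x a) with h | h
  · refine F.linked_of_square_empty hδ hsep hX hY h (fun w h1 h2 h3 h4 => ?_) hrect
    have := hsq w h1 h2 h3
    rw [max_eq_left h, le_max_iff] at this
    exact this.resolve_left (by linarith)
  · refine F.swap.linked_of_square_empty hδ hsep hY hX h (fun w h1 h2 h3 h4 => ?_)
      fun w h1 h2 h3 h4 => hrect w h3 h4 h1 h2
    have := hsq w h2 h1 h3
    simp only [YaoFrame.swap_x, YaoFrame.swap_y] at h4 ⊢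
    rw [max_eq_right h, le_max_iff] at this
    exact this.resolve_right (by linarith)

/-- With (p, q) and (P, Q) the positions of w and b relative to a, equal maxima together with p < P
and q ≤ Q force q = Q; then b cannot be counterclockwise from w. This is where the tie rule of
`Y₄^∞` enters. -/
theorem not_below_and_left_of_ccw {p q P Q : ℝ} (hq : 0 ≤ q)
    (h1 : p < P ∨ p = P ∧ Q < q) (h2 : q < Q ∨ q = Q ∧ p < P)
    (h : max P Q < max p q ∨ max P Q = max p q ∧ 0 < p * Q - q * P) : False := by
  have hpP : p < P := by grind
  have hqQ : q ≤ Q := by grind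
  rcases h with h | ⟨h, h'⟩
  · exact absurd (max_le_max hpP.le hqQ) h.not_ge
  · have : q = Q := by grind
    subst this
    nlinarith

theorem linked_of_yaoFourInfEdge {V : Finset Plane} {E : V → V → Prop} (hE : IsYaoFour E) {a b : V}
    (hab : YaoFourInfEdge a b) :
    LinkedWithin E (fun u v => dist (u : Plane) (v : Plane)) a b
      (40 * dist (a : Plane) (b : Plane)) := by
  obtain ⟨i, hb, hmin⟩ := hab
  obtain ⟨F, hx, hy, hX, hY⟩ := exists_yaoFrame hE
  obtain ⟨δ, hδ, hsep⟩ := exists_forall_dist_ge (V := V)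
  fin_cases i <;> simp only [quadrant, Set.mem_ofPred_eq] at hb hmin
  · have key : ∀ w : V, F.X a < F.X w ∧ F.Y a < F.Y w ↔
        (a : Plane) 0 < (w : Plane) 0 ∧ (a : Plane) 1 ≤ (w : Plane) 1 := fun w => by
      rw [hX, hY]; grind
    have hd : ∀ w : V, (a : Plane) 0 < (w : Plane) 0 ∧ (a : Plane) 1 ≤ (w : Plane) 1 →
        distInf a w = max ((w : Plane) 0 - (a : Plane) 0) ((w : Plane) 1 - (a : Plane) 1) :=
      fun w hw => by
        rw [distInf, abs_of_nonpos (by linarith), abs_of_nonpos (by linarith), neg_sub, neg_sub]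
    have hab := (key b).2 hb
    refine F.linked_of_maximal_square_empty hδ hsep hab.1 hab.2 (fun w h1 h2 h3 => ?_)
      fun w h1 h2 h3 h4 => ?_
    · have hw := (key w).1 ⟨h1, h2⟩
      have := hmin w hw h3
      rw [hd b hb, hd w hw] at this
      simp only [hx, hy]
      exact this.elim le_of_lt fun h => h.1.le
    · have hw := (key w).1 ⟨h1, h3⟩
      have := hmin w hw (YaoFrame.ne_of_X h2)
      rw [hd b hb, hd w hw, IsCCWFrom] at this
      rw [hX] at h2
      rw [hY] at h4
      exact not_below_and_left_of_ccw (p := (w : Plane) 0 - (a : Plane) 0) (q := (w : Plane) 1 - (a : Plane) 1)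
        (P := (b : Plane) 0 - (a : Plane) 0) (Q := (b : Plane) 1 - (a : Plane) 1)
        (by linarith)
        (h2.imp (fun h => by linarith) fun h => ⟨by linarith, by linarith⟩)
        (h4.imp (fun h => by linarith) fun h => ⟨by linarith, by linarith⟩)
        (this.imp id fun h => ⟨h.1, by linarith [h.2]⟩)
  · have key : ∀ w : V, F.X w < F.X a ∧ F.Y a < F.Y w ↔
        (w : Plane) 0 ≤ (a : Plane) 0 ∧ (a : Plane) 1 < (w : Plane) 1 := fun w => by
      rw [hX, hY]; grind
    have hd : ∀ w : V, (w : Plane) 0 ≤ (a : Plane) 0 ∧ (a : Plane) 1 < (w : Plane) 1 →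
        distInf a w = max ((a : Plane) 0 - (w : Plane) 0) ((w : Plane) 1 - (a : Plane) 1) :=
      fun w hw => by
        rw [distInf, abs_of_nonneg (by linarith), abs_of_nonpos (by linarith), neg_sub]
    have hab := (key b).2 hb
    refine F.flipX.linked_of_maximal_square_empty hδ hsep (by simpa using hab.1)
      (by simpa using hab.2) (fun w h1 h2 h3 => ?_) fun w h1 h2 h3 h4 => ?_
    · simp only [YaoFrame.flipX_X, YaoFrame.flipX_Y, neg_lt_neg_iff] at h1 h2
      have hw := (key w).1 ⟨h1, h2⟩
      have := hmin w hw h3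
      rw [hd b hb, hd w hw] at this
      simp only [YaoFrame.flipX_x, YaoFrame.flipX_y, hx, hy, neg_sub_neg]
      exact this.elim le_of_lt fun h => h.1.le
    · simp only [YaoFrame.flipX_X, YaoFrame.flipX_Y, neg_lt_neg_iff] at h1 h2 h3 h4
      have hw := (key w).1 ⟨h1, h3⟩
      have := hmin w hw (YaoFrame.ne_of_X h2).symm
      rw [(hd b hb).trans (max_comm _ _), (hd w hw).trans (max_comm _ _), IsCCWFrom] at this
      rw [hX] at h2
      rw [hY] at h4
      -- A quarter turn carries this quadrant to the first one and preserves orientation, hence the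
      -- exchanged coordinates.
      exact not_below_and_left_of_ccw (p := (w : Plane) 1 - (a : Plane) 1) (q := (a : Plane) 0 - (w : Plane) 0)
        (P := (b : Plane) 1 - (a : Plane) 1) (Q := (a : Plane) 0 - (b : Plane) 0)
        (by linarith)
        (h4.imp (fun h => by linarith) fun h => ⟨by linarith, by linarith⟩)
        (h2.imp (fun h => by linarith) fun h => ⟨by linarith, by linarith⟩)
        (this.imp id fun h => ⟨h.1, by linarith [h.2]⟩)
  · have key : ∀ w : V, F.X w < F.X a ∧ F.Y w < F.Y a ↔
        (w : Plane) 0 < (a : Plane) 0 ∧ (w : Plane) 1 ≤ (a : Plane) 1 := fun w => by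
      rw [hX, hY]; grind
    have hd : ∀ w : V, (w : Plane) 0 < (a : Plane) 0 ∧ (w : Plane) 1 ≤ (a : Plane) 1 →
        distInf a w = max ((a : Plane) 0 - (w : Plane) 0) ((a : Plane) 1 - (w : Plane) 1) :=
      fun w hw => by
        rw [distInf, abs_of_nonneg (by linarith), abs_of_nonneg (by linarith)]
    have hab := (key b).2 hb
    refine F.flipX.flipY.linked_of_maximal_square_empty hδ hsep (by simpa using hab.1)
      (by simpa using hab.2) (fun w h1 h2 h3 => ?_) fun w h1 h2 h3 h4 => ?_
    · simp only [YaoFrame.flipX_X, YaoFrame.flipX_Y, YaoFrame.flipY_X, YaoFrame.flipY_Y, neg_lt_neg_iff] at h1 h2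
      have hw := (key w).1 ⟨h1, h2⟩
      have := hmin w hw h3
      rw [hd b hb, hd w hw] at this
      simp only [YaoFrame.flipX_x, YaoFrame.flipX_y, YaoFrame.flipY_x, YaoFrame.flipY_y, hx, hy, neg_sub_neg]
      exact this.elim le_of_lt fun h => h.1.le
    · simp only [YaoFrame.flipX_X, YaoFrame.flipX_Y, YaoFrame.flipY_X, YaoFrame.flipY_Y, neg_lt_neg_iff] at h1 h2 h3 h4
      have hw := (key w).1 ⟨h1, h3⟩
      have := hmin w hw (YaoFrame.ne_of_X h2).symm
      rw [hd b hb, hd w hw, IsCCWFrom] at this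
      rw [hX] at h2
      rw [hY] at h4
      exact not_below_and_left_of_ccw (p := (a : Plane) 0 - (w : Plane) 0) (q := (a : Plane) 1 - (w : Plane) 1)
        (P := (a : Plane) 0 - (b : Plane) 0) (Q := (a : Plane) 1 - (b : Plane) 1)
        (by linarith)
        (h2.imp (fun h => by linarith) fun h => ⟨by linarith, by linarith⟩)
        (h4.imp (fun h => by linarith) fun h => ⟨by linarith, by linarith⟩)
        (this.imp id fun h => ⟨h.1, by linarith [h.2]⟩)
  · have key : ∀ w : V, F.X a < F.X w ∧ F.Y w < F.Y a ↔
        (a : Plane) 0 ≤ (w : Plane) 0 ∧ (w : Plane) 1 < (a : Plane) 1 := fun w => by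
      rw [hX, hY]; grind
    have hd : ∀ w : V, (a : Plane) 0 ≤ (w : Plane) 0 ∧ (w : Plane) 1 < (a : Plane) 1 →
        distInf a w = max ((w : Plane) 0 - (a : Plane) 0) ((a : Plane) 1 - (w : Plane) 1) :=
      fun w hw => by
        rw [distInf, abs_of_nonpos (by linarith), abs_of_nonneg (by linarith), neg_sub]
    have hab := (key b).2 hb
    refine F.flipY.linked_of_maximal_square_empty hδ hsep (by simpa using hab.1)
      (by simpa using hab.2) (fun w h1 h2 h3 => ?_) fun w h1 h2 h3 h4 => ?_
    · simp only [YaoFrame.flipY_X, YaoFrame.flipY_Y, neg_lt_neg_iff] at h1 h2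
      have hw := (key w).1 ⟨h1, h2⟩
      have := hmin w hw h3
      rw [hd b hb, hd w hw] at this
      simp only [YaoFrame.flipY_x, YaoFrame.flipY_y, hx, hy, neg_sub_neg]
      exact this.elim le_of_lt fun h => h.1.le
    · simp only [YaoFrame.flipY_X, YaoFrame.flipY_Y, neg_lt_neg_iff] at h1 h2 h3 h4
      have hw := (key w).1 ⟨h1, h3⟩
      have := hmin w hw (YaoFrame.ne_of_X h2)
      rw [(hd b hb).trans (max_comm _ _), (hd w hw).trans (max_comm _ _), IsCCWFrom] at this
      rw [hX] at h2
      rw [hY] at h4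
      exact not_below_and_left_of_ccw (p := (a : Plane) 1 - (w : Plane) 1) (q := (w : Plane) 0 - (a : Plane) 0)
        (P := (a : Plane) 1 - (b : Plane) 1) (Q := (b : Plane) 0 - (a : Plane) 0)
        (by linarith)
        (h4.imp (fun h => by linarith) fun h => ⟨by linarith, by linarith⟩)
        (h2.imp (fun h => by linarith) fun h => ⟨by linarith, by linarith⟩)
        (this.imp id fun h => ⟨h.1, by linarith [h.2]⟩)

theorem mainTheorem3 (V : Finset Plane) (E : V → V → Prop) (hE : IsYaoFour E)
    (a b : V) (hab : (yaoFourInf V).Adj a b) :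
    ∃ p : (SimpleGraph.fromRel E).Walk a b, p.IsPath ∧
      walkLength p ≤ (29 + 23 * Real.sqrt 2) * dist (a : Plane) (b : Plane) := by
  classical
  have key : LinkedWithin E (fun u v => dist (u : Plane) (v : Plane)) a b
      (40 * dist (a : Plane) (b : Plane)) := by
    rcases ((SimpleGraph.fromRel_adj _ _ _).1 hab).2 with h | h
    · exact linked_of_yaoFourInfEdge hE h
    · rw [dist_comm]
      exact (linked_of_yaoFourInfEdge hE h).symm fun _ _ => dist_comm _ _
  obtain ⟨p, hp⟩ := key
  -- Cutting out repeated nodes only removes edges, so the walk becomes a path without getting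
  -- longer.
  refine ⟨p.bypass, p.bypass_isPath, ?_⟩
  have hsub : walkLength p.bypass ≤ walkLength p := by
    refine List.Sublist.sum_le_sum (p.darts_bypass_sublist_darts.map _) ?_
    simp only [List.mem_map]
    rintro _ ⟨e, -, rfl⟩
    exact dist_nonneg
  -- Already √2 ≥ 1 gives 29 + 23√2 ≥ 52 ≥ 40.
  have h2 : (1 : ℝ) ≤ Real.sqrt 2 := Real.one_le_sqrt.2 one_le_two
  exact (hsub.trans hp).trans (mul_le_mul_of_nonneg_right (by linarith) dist_nonneg)
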